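/- **Setting.** Let $Q$ be a finite quiver, $K$ a field, $\mathcal P$ the path algebra of $Q$ over $K$ (paths are multiplied by concatenation from left to right; $1_v$ is the trivial path at the vertex $v$), and $\psi:\mathcal P\to\mathcal A$ a surjective homomorphism of $K$-algebras. The paths are the monomials of $\mathcal P$. Let $>$ be a monomial ordering on $\mathcal P$: a total order on paths such that $b_1>b_2$ implies $b_1b>b_2b$ and $b'b_1>b'b_2$ whenever these products are non-zero. A path is standard if it is not the leading monomial of an element of $\ker\psi$. Assume that the images of the standard paths form a $K$-basis $\mathcal B$ of $\mathcal A$; its elements are the monomials of $\mathcal A$, ordered through their lifts $\lambda(b)$ (the standard path with $\psi(\lambda(b))=b$). Assume that there is no infinite strictly decreasing sequence in $\mathcal B$ (admissibility). For $b,c\in\mathcal B$, call $c$ a small cofactor of $b$ if $\lambda(b)\lambda(c)$ is a non-zero standard path; $c$ is the cofactor of a minimal toppling of $b$ if it is not a small cofactor of $b$, but every $c'\ne c$ in $\mathcal B$ for which $\lambda(c')$ is an initial piece of $\lambda(c)$ is one. Let $F=\mathcal A^r$ and $E=\mathcal P^m$ be free right modules with free generators $\mathfrak v_1,\dots,\mathfrak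 v_r$ and $\mathfrak e_1,\dots,\mathfrak e_m$. Their monomials are the $\mathfrak v_ib$ ($b\in\mathcal B$) and the $\mathfrak e_ib$ ($b$ a path). Fix total orders on $\mathrm{Mon}(F)$ and $\mathrm{Mon}(E)$ compatible with $>$: $b_1>b_2$ implies $\mathfrak v_ib_1>\mathfrak v_ib_2$ and $\mathfrak e_ib_1>\mathfrak e_ib_2$; if $\mathfrak v_ib_1>\mathfrak v_jb_2$, $b$ is a small cofactor of $b_1$ and $b_2b\neq0$ then $\mathfrak v_ib_1b>\mathfrak v_j\mathrm{LM}(b_2b)$; if $\mathfrak e_ib_1>\mathfrak e_jb_2$ and $b_1b,b_2b\ne0$ then $\mathfrak e_ib_1b>\mathfrak e_jb_2b$. $\mathrm{LM}$ and $\mathrm{LC}$ denote leading monomials and coefficients. Let $M\subset F$ be the submodule generated by $\hat g_1,\dots,\hat g_m$, and $ev:E\to M$, $\mathfrak e_ic\mapsto\hat g_i\psi(c)$. A signed element of $M\setminus\{0\}$ is a pair $f=(\mathrm{poly}(f),\sigma(f))$ with $0\ne\mathrm{poly}(f)\in M$, $\sigma(f)\in\mathrm{Mon}(E)$, such that some $\tilde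 f\in E$ has $\mathrm{LM}(\tilde f)=\sigma(f)$ and $ev(\tilde f)=\mathrm{poly}(f)$. Write $\mathrm{LM}(f)=\mathrm{LM}(\mathrm{poly}(f))$ and $\mathrm{LC}(f)=\mathrm{LC}(\mathrm{poly}(f))$. For a set $G$ of signed elements and $s\in\mathrm{Mon}(E)$, a non-zero $f\in F$ is $s$-reducible (weakly $s$-reducible) with respect to $G$ if there are $g\in G$ and a small cofactor $c$ of $\mathrm{LM}(g)$ such that $\mathrm{LM}(g)c=\mathrm{LM}(f)$ and $\sigma(g)\lambda(c)$ is non-zero and $<s$ ($\le s$). An element of $F$ that is not $s$-reducible is $s$-irreducible; for a signed element $f$, (weakly) (ir)reducible refers to $\mathrm{poly}(f)$ and $s=\sigma(f)$. $G$ is interreduced if every $g\in G$ is irreducible with respect to $G$ and there are no $g'\neq g$ in $G$ with a small cofactor $c$ of $\mathrm{LM}(g')$ such that $\mathrm{LM}(g')c=\mathrm{LM}(g)$ and $\sigma(g')\lambda(c)=\sigma(g)$. A finite set $G$ of signed elements of $M\setminus\{0\}$ is a signed standard basis of $M$ if every signed element of $M\setminus\{0\}$ that is irreducible with respect to (the set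 of all signed elements of) $M\setminus\{0\}$ is weakly reducible with respect to $G$. **Critical pairs.** A critical pair of $G$ of type T is $(g,c)$ with $g\in G$ and $c$ the cofactor of a minimal toppling of $\mathrm{LM}(g)$; its S-polynomial is $(\mathrm{poly}(g)c,\ \sigma(g)\lambda(c))$. A critical pair of type S is $(g,g')$ with $g,g'\in G$ and a small cofactor $c$ of $\mathrm{LM}(g)$ such that $\mathrm{LM}(g')=\mathrm{LM}(g)c$, $\sigma(g)\lambda(c)\neq 0$ and $\sigma(g')<\sigma(g)\lambda(c)$; its S-polynomial is $(\mathrm{poly}(g)c-\frac{\mathrm{LC}(g)}{\mathrm{LC}(g')}\mathrm{poly}(g'),\ \sigma(g)\lambda(c))$. For $L\subset\mathrm{Mon}(E)$, a monomial $\mathfrak e_ic$ of $E$ is standard relative to $L$ if $c$ is a standard path and there are no $\mathfrak e_ic'\in L$ and path $d$ with $c=c'd$. A critical pair is normal relative to $L$ if the signature of its S-polynomial is a (non-zero) monomial that is standard relative to $L$, and its member $g$ (for type S: both members $g,g'$) is irreducible with respect to $G$. **The algorithm** ($F_5$). The signed normal form of $f\in F$ with respect to $G$ and $s$ is computed by repeating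 $f\leftarrow f-\frac{\mathrm{LC}(f)}{\mathrm{LC}(g)}\mathrm{poly}(g)c$, as long as $f$ is $s$-reducible by some $g\in G$ with small cofactor $c$. A set $G$ is interreduced by repeating the following until it is interreduced: either remove an element $g$ for which some $g'\ne g$ in $G$ has a small cofactor $c$ of $\mathrm{LM}(g')$ with $\mathrm{LM}(g')c=\mathrm{LM}(g)$ and $\sigma(g')\lambda(c)=\sigma(g)$; or choose $g\in G$ reducible with respect to $G\setminus\{g\}$ and replace $\mathrm{poly}(g)$ by its signed normal form with respect to $G\setminus\{g\}$ and $\sigma(g)$, removing the element from $G$ and putting $\sigma(g)$ into $L$ if the normal form is zero. 1. Let $G$ be the interreduction of the set of the signed elements $(\hat g_i1_v,\ \mathfrak e_i1_v)$ with $\hat g_i1_v\ne0$ ($i=1,\dots,m$, $v$ a vertex); then let $L=\emptyset$. 2. While there is a critical pair $p$ of $G$, normal relative to $L$, with S-polynomial of signature $s$, for which there are no $g\in G$ and small cofactor $c$ of $\mathrm{LM}(g)$ such that $\sigma(g)\lambda(c)=s$ and $\mathrm{poly}(g)c$ is $s$-irreducible with respect to $G$: choose such a $p$ and compute the signed normal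 form $f$ of its S-polynomial with respect to $G$ and $s$. If $f=0$, add $s$ to $L$; otherwise replace $G$ by the interreduction of $G\cup\{(f,s)\}$, enlarging $L$ if zero reductions occur. 3. Return $G$. All choices are arbitrary. An elementary step is one test of the while condition (with the choice of $p$), one top reduction $f\leftarrow f-\frac{\mathrm{LC}(f)}{\mathrm{LC}(g)}\mathrm{poly}(g)c$, or one choice, removal, replacement or test for completion in an interreduction. **Theorem.** For every run of the algorithm: (1) if the run terminates, then it returns an interreduced signed standard basis of $M$; (2) the run terminates after finitely many elementary steps if and only if the body of the while loop is executed only finitely many times; (3) whenever the while condition is tested, every element of $L$ is the leading monomial of an element of $\ker(ev)$, and for all $i$ and $v$ such that $\mathfrak e_i1_v$ is not the leading monomial of an element of $\ker(ev)$ there is some $g\in G$ with $\sigma(g)=\mathfrak e_i1_v$. -/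

import Mathlib

/-! ### Path algebras -/

namespace SigF5

open MulOpposite

/-- A monomial of the path algebra: a directed path in the quiver `V`. -/
structure PathMon (V : Type*) [Quiver V] where
  src : V
  tgt : V
  path : Quiver.Path src tgt

namespace PathMon

variable {V : Type*} [Quiver V]

/-- The trivial path `1_v`. -/
def triv (v : V) : PathMon V := ⟨v, v, Quiver.Path.nil⟩

open Classical in
/-- The product of two monomials: concatenation of paths, where `none` stands for the product `0`
(the first path does not end where the second one starts). -/
noncomputable def mul (a b : PathMon V) : Option (PathMon V) :=
  if h : a.tgt = b.src then some ⟨a.src, b.tgt, (h ▸ a.path : Quiver.Path a.src b.src).comp b.path⟩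
  else none

theorem mul_mk {u v w : V} (p : Quiver.Path u v) (q : Quiver.Path v w) :
    mul (⟨u, v, p⟩ : PathMon V) ⟨v, w, q⟩ = some ⟨u, w, p.comp q⟩ := by
  simp [mul]

theorem mul_of_ne {a b : PathMon V} (h : a.tgt ≠ b.src) : a.mul b = none := by
  simp [mul, h]

theorem mul_assoc_bind (a b c : PathMon V) :
    ((a.mul b).bind fun x => x.mul c) = (b.mul c).bind fun x => a.mul x := by
  obtain ⟨a1, a2, p⟩ := a
  obtain ⟨b1, b2, q⟩ := b
  obtain ⟨c1, c2, s⟩ := c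
  by_cases h : a2 = b1
  · subst h
    by_cases h' : b2 = c1
    · subst h'
      simp [mul_mk, Quiver.Path.comp_assoc]
    · rw [mul_mk, mul_of_ne (a := ⟨a2, b2, q⟩) h']
      exact mul_of_ne h'
  · rw [mul_of_ne (a := ⟨a1, a2, p⟩) h]
    by_cases h' : b2 = c1
    · subst h'
      rw [mul_mk]
      exact (mul_of_ne h).symm
    · rw [mul_of_ne (a := ⟨b1, b2, q⟩) h']
      rfl

theorem triv_mul (v : V) (b : PathMon V) (h : v = b.src) : (triv v).mul b = some b := by
  subst h
  obtain ⟨b1, b2, q⟩ := b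
  simp [triv, mul_mk]

theorem mul_triv (b : PathMon V) (v : V) (h : b.tgt = v) : b.mul (triv v) = some b := by
  subst h
  obtain ⟨b1, b2, q⟩ := b
  simp [triv, mul_mk]

end PathMon

/-- The path algebra of the quiver `V` over `K`: the paths form a `K`-basis. -/
def PathAlgebra (K V : Type*) [Field K] [Quiver V] := PathMon V →₀ K

namespace PathAlgebra

variable {K V : Type*} [Field K] [Quiver V]

noncomputable instance : AddCommGroup (PathAlgebra K V) :=
  inferInstanceAs (AddCommGroup (PathMon V →₀ K))

noncomputable instance : Module K (PathAlgebra K V) :=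
  inferInstanceAs (Module K (PathMon V →₀ K))

/-- The monomial `b` as an element of the path algebra. -/
noncomputable def of (K : Type*) [Field K] (b : PathMon V) : PathAlgebra K V := Finsupp.single b 1

/-- The coefficient of `p` at the monomial `b`. -/
def coeff (p : PathAlgebra K V) (b : PathMon V) : K := (show PathMon V →₀ K from p) b

/-- A monomial or zero, as an element of the path algebra. -/
noncomputable def ofOption (K : Type*) [Field K] (b : Option (PathMon V)) : PathAlgebra K V :=
  b.elim 0 (of K)

/-- The bilinear multiplication that extends concatenation of paths. -/
noncomputable def mulHom : PathAlgebra K V →ₗ[K] PathAlgebra K V →ₗ[K] PathAlgebra K V :=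
  Finsupp.linearCombination K fun a : PathMon V =>
    Finsupp.linearCombination K fun b : PathMon V => ofOption K (a.mul b)

theorem mulHom_of (a b : PathMon V) : mulHom (of K a) (of K b) = ofOption K (a.mul b) := by
  have h1 : mulHom (of K a) = Finsupp.linearCombination K
      fun b : PathMon V => (ofOption K (a.mul b) : PathAlgebra K V) := by
    unfold mulHom of
    exact (Finsupp.linearCombination_single K 1 a).trans (one_smul K _)
  rw [h1]
  exact (Finsupp.linearCombination_single K 1 b).trans (one_smul K _)

theorem hom_ext {N : Type*} [AddCommGroup N] [Module K N] {f g : PathAlgebra K V →ₗ[K] N}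
    (h : ∀ b, f (of K b) = g (of K b)) : f = g :=
  Finsupp.lhom_ext' fun b => LinearMap.ext_ring (h b)

theorem mulHom_ofOption_right (a : PathMon V) (o : Option (PathMon V)) :
    mulHom (of K a) (ofOption K o) = ofOption K (o.bind fun x => a.mul x) := by
  cases o with
  | none => exact map_zero _
  | some b => exact mulHom_of a b

theorem mulHom_ofOption_left (o : Option (PathMon V)) (c : PathMon V) :
    mulHom (ofOption K o) (of K c) = ofOption K (o.bind fun x => x.mul c) := by
  cases o with
  | none => exact congrArg (fun f => f (of K c)) (map_zero mulHom)
  | some b => exact mulHom_of b c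

theorem mulHom_assoc (p q s : PathAlgebra K V) :
    mulHom (mulHom p q) s = mulHom p (mulHom q s) := by
  have h1 (a b : PathMon V) : mulHom (mulHom (of K a) (of K b)) =
      (mulHom (of K a)).comp (mulHom (of K b)) := by
    refine hom_ext fun c => ?_
    rw [LinearMap.comp_apply, mulHom_of, mulHom_of, mulHom_ofOption_left, mulHom_ofOption_right,
      PathMon.mul_assoc_bind]
  have h2 (a : PathMon V) : (mulHom (K := K) (V := V)).comp (mulHom (of K a)) =
      mulHom.compr₂ (mulHom (of K a)) := hom_ext fun b => h1 a b
  have h3 : (mulHom.flip s).comp (mulHom.flip q) = mulHom.flip (mulHom q s) :=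
    hom_ext fun a => congrArg (fun f => f q s) (h2 a)
  exact congrArg (fun f => f p) h3

variable [Fintype V]

/-- The unit `∑ v, 1_v`. -/
noncomputable def unit : PathAlgebra K V := ∑ v : V, of K (PathMon.triv v)

theorem mulHom_unit_left (p : PathAlgebra K V) : mulHom unit p = p := by
  have key : mulHom (K := K) (V := V) unit = LinearMap.id := by
    refine hom_ext fun b => ?_
    rw [unit, map_sum, LinearMap.sum_apply, Finset.sum_eq_single b.src]
    · rw [mulHom_of, PathMon.triv_mul _ _ rfl]; rfl
    · intro v _ hv
      rw [mulHom_of, PathMon.mul_of_ne (a := PathMon.triv v) hv]; rfl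
    · intro h
      exact absurd (Finset.mem_univ _) h
  rw [key]; rfl

theorem mulHom_unit_right (p : PathAlgebra K V) : mulHom p unit = p := by
  have key : (mulHom (K := K) (V := V)).flip unit = LinearMap.id := by
    refine hom_ext fun b => ?_
    rw [LinearMap.flip_apply, unit, map_sum, Finset.sum_eq_single b.tgt]
    · rw [mulHom_of, PathMon.mul_triv _ _ rfl]; rfl
    · intro v _ hv
      rw [mulHom_of, PathMon.mul_of_ne (b := PathMon.triv v) (Ne.symm hv)]; rfl
    · intro h
      exact absurd (Finset.mem_univ _) h
  exact congrArg (fun f => f p) key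

noncomputable instance : Ring (PathAlgebra K V) :=
  { (inferInstance : AddCommGroup (PathAlgebra K V)) with
    mul := fun p q => mulHom p q
    one := unit
    left_distrib := fun p q s => map_add (mulHom p) q s
    right_distrib := fun p q s => LinearMap.map_add₂ mulHom p q s
    zero_mul := fun p => LinearMap.map_zero₂ mulHom p
    mul_zero := fun p => map_zero (mulHom p)
    mul_assoc := mulHom_assoc
    one_mul := mulHom_unit_left
    mul_one := mulHom_unit_right }

noncomputable instance : Algebra K (PathAlgebra K V) :=
  Algebra.ofModule (fun x p q => LinearMap.map_smul₂ mulHom x p q)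
    (fun x p q => map_smul (mulHom p) x q)

theorem of_mul_of (a b : PathMon V) : of K a * of K b = ofOption K (a.mul b) := mulHom_of a b

end PathAlgebra

open PathAlgebra

/-! ### Monomial orderings and the preferred basis of a quotient of the path algebra -/

/-- The given total order on paths is a monomial ordering: products with a monomial from either
side preserve strict inequalities, as long as they are non-zero. -/
structure IsMonomialOrdering (V : Type*) [Quiver V] [LinearOrder (PathMon V)] : Prop where
  mul_right : ∀ b₁ b₂ b c₁ c₂ : PathMon V, b₂ < b₁ → b₁.mul b = some c₁ → b₂.mul b = some c₂ →
    c₂ < c₁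
  mul_left : ∀ b₁ b₂ b c₁ c₂ : PathMon V, b₂ < b₁ → b.mul b₁ = some c₁ → b.mul b₂ = some c₂ →
    c₂ < c₁

section Quotient

variable {K V A : Type*} [Field K] [Quiver V] [Fintype V] [LinearOrder (PathMon V)]
  [Ring A] [Algebra K A]

/-- `b` is the leading monomial of `p`. -/
def IsLeadP (p : PathAlgebra K V) (b : PathMon V) : Prop :=
  p.coeff b ≠ 0 ∧ ∀ b', p.coeff b' ≠ 0 → b' ≤ b

/-- `b` is a standard monomial: not a leading monomial of an element of `ker ψ`. -/
def IsStd (ψ : PathAlgebra K V →ₐ[K] A) (b : PathMon V) : Prop :=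
  ¬ ∃ p : PathAlgebra K V, ψ p = 0 ∧ IsLeadP p b

/-- The standard monomials. A monomial of `A` is `ψ b` for a unique standard `b` (its lift), and
monomials of `A` are represented by their lifts throughout; the order is the induced one. -/
abbrev StdMon (ψ : PathAlgebra K V →ₐ[K] A) := {b : PathMon V // IsStd ψ b}

/-- The monomial of `A` with lift `b`. -/
noncomputable def StdMon.val (ψ : PathAlgebra K V →ₐ[K] A) (b : StdMon ψ) : A := ψ (of K b.1)

/-- The monomials of `A` span `A` over `K` (they are always linearly independent, so that this says
that they form a basis). -/
def HasPreferredBasis (ψ : PathAlgebra K V →ₐ[K] A) : Prop :=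
  Submodule.span K (Set.range (StdMon.val ψ)) = ⊤

/-- The monomial ordering on `A` is admissible: there is no infinite strictly decreasing sequence of
monomials of `A`. -/
def IsAdmissible (ψ : PathAlgebra K V →ₐ[K] A) : Prop :=
  ¬ ∃ f : ℕ → StdMon ψ, ∀ n, f (n + 1) < f n

/-- `b` is the leading monomial of `a ∈ A`: the expansion of `a` in monomials of `A`, lifted to
`p`, has `b` as its greatest monomial. -/
def IsLeadA (ψ : PathAlgebra K V →ₐ[K] A) (a : A) (b : StdMon ψ) : Prop :=
  ∃ p : PathAlgebra K V, (∀ b', p.coeff b' ≠ 0 → IsStd ψ b') ∧ ψ p = a ∧ IsLeadP p b.1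

/-- `b` strictly divides `c`: the lift of `b` is an initial piece of the lift of `c`. -/
def StrictDvd (ψ : PathAlgebra K V →ₐ[K] A) (b c : StdMon ψ) : Prop :=
  ∃ d : PathMon V, b.1.mul d = some c.1

/-- `c` is a small cofactor of `b`: the lifts of `b` and `c` have a non-zero product, and it is a
standard monomial (the lift of the monomial `b · c` of `A`). -/
def IsSmallCofactor (ψ : PathAlgebra K V →ₐ[K] A) (b c : StdMon ψ) : Prop :=
  ∃ d : StdMon ψ, b.1.mul c.1 = some d.1

/-- `c` is cofactor of a minimal toppling of `b`: it is not a small cofactor of `b`, whereas all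
proper strict divisors of `c` are. -/
def IsMinTopplingCofactor (ψ : PathAlgebra K V →ₐ[K] A) (b c : StdMon ψ) : Prop :=
  ¬ IsSmallCofactor ψ b c ∧ ∀ c' : StdMon ψ, StrictDvd ψ c' c → c' ≠ c → IsSmallCofactor ψ b c'

end Quotient

/-! ### Monomials of free modules -/

/-- The monomial `(free generator number idx) · mon` of a free module of rank `n`. -/
@[ext] structure ModMon (n : ℕ) (S : Type*) where
  idx : Fin n
  mon : S

section Modules

variable {K V A : Type*} [Field K] [Quiver V] [Fintype V] [LinearOrder (PathMon V)]
  [Ring A] [Algebra K A] (ψ : PathAlgebra K V →ₐ[K] A) {r m : ℕ}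

/-- Monomials of the free right module `F = A ^ r`. -/
abbrev FMon (r : ℕ) := ModMon r (StdMon ψ)

/-- Monomials of the free right module `E = P ^ m` over the path algebra. -/
abbrev EMon (V : Type*) [Quiver V] (m : ℕ) := ModMon m (PathMon V)

/-- `u · c = t` in `Mon F`, where `c` is a small cofactor of (the monomial of `A` in) `u`. -/
def FMon.MulEq {ψ : PathAlgebra K V →ₐ[K] A} (u : FMon ψ r) (c : StdMon ψ) (t : FMon ψ r) : Prop :=
  t.idx = u.idx ∧ u.mon.1.mul c.1 = some t.mon.1

/-- `u · d = s` in `Mon E`; in particular the product is not zero. -/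
def EMon.MulEq {V : Type*} [Quiver V] {m : ℕ} (u : EMon V m) (d : PathMon V) (s : EMon V m) :
    Prop :=
  s.idx = u.idx ∧ u.mon.mul d = some s.mon

/-- The order on `Mon F` is a monomial ordering compatible with the one on `A`. -/
structure IsCompatibleF (r : ℕ) [LinearOrder (FMon ψ r)] : Prop where
  of_lt : ∀ (i : Fin r) (b₁ b₂ : StdMon ψ), b₂ < b₁ → (⟨i, b₂⟩ : FMon ψ r) < ⟨i, b₁⟩
  mul : ∀ (u₁ u₂ t : FMon ψ r) (b l : StdMon ψ), u₂ < u₁ → u₁.MulEq b t →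
    IsLeadA ψ (StdMon.val ψ u₂.mon * StdMon.val ψ b) l → (⟨u₂.idx, l⟩ : FMon ψ r) < t

/-- The order on `Mon E` is a monomial ordering compatible with the one on the path algebra. -/
structure IsCompatibleE (V : Type*) [Quiver V] [LinearOrder (PathMon V)] (m : ℕ)
    [LinearOrder (EMon V m)] : Prop where
  of_lt : ∀ (i : Fin m) (b₁ b₂ : PathMon V), b₂ < b₁ → (⟨i, b₂⟩ : EMon V m) < ⟨i, b₁⟩
  mul : ∀ (u₁ u₂ t₁ t₂ : EMon V m) (b : PathMon V), u₂ < u₁ → u₁.MulEq b t₁ → u₂.MulEq b t₂ →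
    t₂ < t₁

/-- The leading term of `f ∈ F` is `a · t`: the expansion of `f` in monomials of `F`, lifted to
`q`, has `t` as its greatest monomial, with coefficient `a`. -/
def IsLT [LinearOrder (FMon ψ r)] (f : Fin r → A) (t : FMon ψ r) (a : K) : Prop :=
  ∃ q : Fin r → PathAlgebra K V, (∀ j b, (q j).coeff b ≠ 0 → IsStd ψ b) ∧ (∀ j, ψ (q j) = f j) ∧
    (q t.idx).coeff t.mon.1 = a ∧ a ≠ 0 ∧
    ∀ u : FMon ψ r, (q u.idx).coeff u.mon.1 ≠ 0 → u ≤ t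

/-- `t` is the leading monomial of `f ∈ F`. -/
def IsLM [LinearOrder (FMon ψ r)] (f : Fin r → A) (t : FMon ψ r) : Prop := ∃ a : K, IsLT ψ f t a

/-- `s` is the leading monomial of `p ∈ E`. -/
def IsLeadE [LinearOrder (EMon V m)] (p : Fin m → PathAlgebra K V) (s : EMon V m) : Prop :=
  (p s.idx).coeff s.mon ≠ 0 ∧ ∀ u : EMon V m, (p u.idx).coeff u.mon ≠ 0 → u ≤ s

/-- The evaluation map `ev : E → F`, `ev (𝔢 i · c) = ĝ i · ψ c`. -/
noncomputable def ev (ghat : Fin m → Fin r → A) (p : Fin m → PathAlgebra K V) : Fin r → A :=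
  ∑ i, op (ψ (p i)) • ghat i

/-- `s` is the leading monomial of an element of `ker ev`. -/
def IsKerLM [LinearOrder (EMon V m)] (ghat : Fin m → Fin r → A) (s : EMon V m) : Prop :=
  ∃ p : Fin m → PathAlgebra K V, ev ψ ghat p = 0 ∧ IsLeadE p s

end Modules

/-! ### Signed elements, reducibility, signed standard bases -/

/-- A pair formed by an element of `F = A ^ r` and a monomial of `E`, its signature. -/
@[ext] structure SPair (A V : Type*) [Quiver V] (r m : ℕ) where
  poly : Fin r → A
  sig : EMon V m

section Signed

variable {K V A : Type*} [Field K] [Quiver V] [Fintype V] [LinearOrder (PathMon V)]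
  [Ring A] [Algebra K A] (ψ : PathAlgebra K V →ₐ[K] A) {r m : ℕ}
  [LinearOrder (FMon ψ r)] [LinearOrder (EMon V m)]

/-- The signed elements of `M ∖ {0}`. -/
def signedElements (M : Submodule Aᵐᵒᵖ (Fin r → A)) (ghat : Fin m → Fin r → A) :
    Set (SPair A V r m) :=
  {f | f.poly ∈ M ∧ f.poly ≠ 0 ∧
    ∃ p : Fin m → PathAlgebra K V, IsLeadE p f.sig ∧ ev ψ ghat p = f.poly}

/-- `c` is a small cofactor of `LM(g)` with `LM(g) · c = t` and `σ(g) · λ(c) = s`. -/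
def HasMultiple (g : SPair A V r m) (c : StdMon ψ) (t : FMon ψ r) (s : EMon V m) : Prop :=
  (∃ u : FMon ψ r, IsLM ψ g.poly u ∧ u.MulEq c t) ∧ g.sig.MulEq c.1 s

/-- `f` is `s`-reducible with respect to `G`. -/
def IsReducible (f : Fin r → A) (s : EMon V m) (G : Set (SPair A V r m)) : Prop :=
  ∃ t, IsLM ψ f t ∧ ∃ g ∈ G, ∃ c s', HasMultiple ψ g c t s' ∧ s' < s

/-- `f` is weakly `s`-reducible with respect to `G`. -/
def IsWeaklyReducible (f : Fin r → A) (s : EMon V m) (G : Set (SPair A V r m)) : Prop :=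
  ∃ t, IsLM ψ f t ∧ ∃ g ∈ G, ∃ c s', HasMultiple ψ g c t s' ∧ s' ≤ s

/-- `f` is `s`-irreducible with respect to `G`. -/
def IsIrreducible (f : Fin r → A) (s : EMon V m) (G : Set (SPair A V r m)) : Prop :=
  f = 0 ∨ ¬ IsReducible ψ f s G

/-- `g` is redundant because of `g'`: there is a small cofactor `c` of `LM(g')` with
`LM(g') · c = LM(g)` and `σ(g') · λ(c) = σ(g)`. -/
def IsCovered (g g' : SPair A V r m) : Prop :=
  ∃ t c, IsLM ψ g.poly t ∧ HasMultiple ψ g' c t g.sig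

/-- `G` is interreduced. -/
def IsInterreduced (G : Set (SPair A V r m)) : Prop :=
  (∀ g ∈ G, IsIrreducible ψ g.poly g.sig G) ∧ ∀ g ∈ G, ∀ g' ∈ G, g' ≠ g → ¬ IsCovered ψ g g'

/-- `G` is a signed standard basis of `M`: a finite set of signed elements of `M ∖ {0}` such that
each signed element `f` of `M ∖ {0}` that is `σ(f)`-irreducible with respect to `M ∖ {0}` is weakly
`σ(f)`-reducible with respect to `G`. -/
def IsSignedStandardBasis (M : Submodule Aᵐᵒᵖ (Fin r → A)) (ghat : Fin m → Fin r → A)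
    (G : Set (SPair A V r m)) : Prop :=
  G.Finite ∧ G ⊆ signedElements ψ M ghat ∧
    ∀ f ∈ signedElements ψ M ghat, IsIrreducible ψ f.poly f.sig (signedElements ψ M ghat) →
      IsWeaklyReducible ψ f.poly f.sig G

/-! ### Critical pairs -/

/-- A critical pair, of type T or of type S, together with its cofactor `c`. -/
inductive CritPair
  | typeT (g : SPair A V r m) (c : StdMon ψ)
  | typeS (g g' : SPair A V r m) (c : StdMon ψ)

/-- `s` is the signature `σ(g) · λ(c)` of the S-polynomial of the pair. -/
def CritPair.HasSig : CritPair (r := r) (m := m) ψ → EMon V m → Prop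
  | .typeT g c, s => g.sig.MulEq c.1 s
  | .typeS g _ c, s => g.sig.MulEq c.1 s

/-- `p` is a critical pair of `G`. -/
def CritPair.IsPairOf (G : Set (SPair A V r m)) : CritPair (r := r) (m := m) ψ → Prop
  | .typeT g c => g ∈ G ∧ ∃ u : FMon ψ r, IsLM ψ g.poly u ∧ IsMinTopplingCofactor ψ u.mon c
  | .typeS g g' c => g ∈ G ∧ g' ∈ G ∧
      ∃ t s, IsLM ψ g'.poly t ∧ HasMultiple ψ g c t s ∧ g'.sig < s

/-- `f` is the unsigned S-polynomial of the pair. -/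
def CritPair.IsSPoly : CritPair (r := r) (m := m) ψ → (Fin r → A) → Prop
  | .typeT g c, f => f = op (StdMon.val ψ c) • g.poly
  | .typeS g g' c, f => ∃ u u' a a', IsLT ψ g.poly u a ∧ IsLT ψ g'.poly u' a' ∧
      f = op (StdMon.val ψ c) • g.poly - (a / a') • g'.poly

/-- The members of the pair are irreducible with respect to `G`. -/
def CritPair.MembersIrreducible (G : Set (SPair A V r m)) : CritPair (r := r) (m := m) ψ → Prop
  | .typeT g _ => IsIrreducible ψ g.poly g.sig G
  | .typeS g g' _ => IsIrreducible ψ g.poly g.sig G ∧ IsIrreducible ψ g'.poly g'.sig G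

/-- The monomial `s` of `E` is standard relative to `L`: its path is a standard monomial, and `s` is
not a multiple (from the right) of an element of `L`. -/
def IsStdRel (L : Set (EMon V m)) (s : EMon V m) : Prop :=
  IsStd ψ s.mon ∧ ¬ ∃ u ∈ L, ∃ d : PathMon V, u.MulEq d s

/-- The critical pair `p` of `G`, with an S-polynomial of signature `s`, is normal relative to
`L`. -/
def IsNormalRel (G : Set (SPair A V r m)) (L : Set (EMon V m)) (p : CritPair (r := r) (m := m) ψ)
    (s : EMon V m) : Prop :=
  p.IsPairOf ψ G ∧ p.HasSig ψ s ∧ IsStdRel ψ L s ∧ p.MembersIrreducible ψ G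

/-- There are `g ∈ G` and a small cofactor `c` of `LM(g)` with `σ(g) · λ(c) = s`, such that
`poly(g) · c` is `s`-irreducible with respect to `G`. -/
def IsRewritable (G : Set (SPair A V r m)) (s : EMon V m) : Prop :=
  ∃ g ∈ G, ∃ c t, HasMultiple ψ g c t s ∧
    IsIrreducible ψ (op (StdMon.val ψ c) • g.poly) s G

/-- The condition of the while loop holds for the pair `p`, with an S-polynomial of signature
`s`. -/
def LoopCondition (G : Set (SPair A V r m)) (L : Set (EMon V m))
    (p : CritPair (r := r) (m := m) ψ) (s : EMon V m) : Prop :=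
  IsNormalRel ψ G L p s ∧ ¬ IsRewritable ψ G s

/-! ### The algorithm, as a non-deterministic transition system -/

/-- One pass through the loop of the signed normal form algorithm: `f` is replaced by
`f - (LC(f) / LC(g)) · poly(g) · c`, where `LM(g) · c = LM(f)` and `σ(g) · λ(c) < s`. -/
def TopReduction (G : Set (SPair A V r m)) (s : EMon V m) (f f' : Fin r → A) : Prop :=
  ∃ t a, IsLT ψ f t a ∧ ∃ g ∈ G, ∃ c s', HasMultiple ψ g c t s' ∧ s' < s ∧
    ∃ u a', IsLT ψ g.poly u a' ∧ f' = f - (a / a') • (op (StdMon.val ψ c) • g.poly)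

/-- A state of the interreduction procedure: the current set, the signatures of the zero reductions
(added to `L`), and, if some `g` is currently being reduced, the pair `(g, remainder)`. -/
structure InterState (A V : Type*) [Quiver V] (r m : ℕ) where
  G : Set (SPair A V r m)
  L : Set (EMon V m)
  work : Option (SPair A V r m × (Fin r → A))

/-- The steps of the interreduction procedure: remove a redundant element; or choose an element
that is reducible with respect to the others, compute its signed normal form with respect to them,
and put this in place of the element, or, if it is zero, just remove the element and enlarge `L`
by its signature. -/
inductive InterStep : InterState A V r m → InterState A V r m → Prop
  | drop (G L g g') : g ∈ G → g' ∈ G → g' ≠ g → IsCovered ψ g g' →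
      InterStep ⟨G, L, none⟩ ⟨G \ {g}, L, none⟩
  | choose (G L g) : g ∈ G → IsReducible ψ g.poly g.sig (G \ {g}) →
      InterStep ⟨G, L, none⟩ ⟨G, L, some (g, g.poly)⟩
  | reduce (G L g f f') : TopReduction ψ (G \ {g}) g.sig f f' →
      InterStep ⟨G, L, some (g, f)⟩ ⟨G, L, some (g, f')⟩
  | replace (G L g f) : f ≠ 0 → IsIrreducible ψ f g.sig (G \ {g}) →
      InterStep ⟨G, L, some (g, f)⟩ ⟨insert ⟨f, g.sig⟩ (G \ {g}), L, none⟩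
  | vanish (G L g) : InterStep ⟨G, L, some (g, 0)⟩ ⟨G \ {g}, insert g.sig L, none⟩

/-- The states of the algorithm: interreducing the initial set; testing the condition of the while
loop; computing the normal form of an S-polynomial of signature `s`, with current remainder `f`;
interreducing the enlarged set; having returned `G`. -/
inductive State (A V : Type*) [Quiver V] (r m : ℕ)
  | start (S : InterState A V r m)
  | loopHead (G : Set (SPair A V r m)) (L : Set (EMon V m))
  | normalForm (G : Set (SPair A V r m)) (L : Set (EMon V m)) (s : EMon V m) (f : Fin r → A)
  | update (S : InterState A V r m)
  | returned (G : Set (SPair A V r m))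

/-- The steps of the algorithm; all choices are left open. -/
inductive Step : State A V r m → State A V r m → Prop
  | startStep (S S') : InterStep ψ S S' → Step (.start S) (.start S')
  | startDone (G L) : IsInterreduced ψ G → Step (.start ⟨G, L, none⟩) (.loopHead G ∅)
  | loopExit (G L) : (∀ p s, ¬ LoopCondition ψ G L p s) → Step (.loopHead G L) (.returned G)
  | loopEnter (G L p s f) : LoopCondition ψ G L p s → p.IsSPoly ψ f →
      Step (.loopHead G L) (.normalForm G L s f)
  | reduce (G L s f f') : TopReduction ψ G s f f' →
      Step (.normalForm G L s f) (.normalForm G L s f')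
  | zero (G L s) : Step (.normalForm G L s 0) (.loopHead G (insert s L))
  | nonzero (G L s f) : f ≠ 0 → IsIrreducible ψ f s G →
      Step (.normalForm G L s f) (.update ⟨insert ⟨f, s⟩ G, L, none⟩)
  | updateStep (S S') : InterStep ψ S S' → Step (.update S) (.update S')
  | updateDone (G L) : IsInterreduced ψ G → Step (.update ⟨G, L, none⟩) (.loopHead G L)

/-- The input of the algorithm: the non-zero signed elements `(ĝ i · 1_v, 𝔢 i · 1_v)`. (If the
quiver has a single vertex, then these are the non-zero ones among the `(ĝ i, 𝔢 i)`.) -/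
def initialSet (ghat : Fin m → Fin r → A) : Set (SPair A V r m) :=
  {f | f.poly ≠ 0 ∧ ∃ (i : Fin m) (v : V),
    f = ⟨op (ψ (of K (PathMon.triv v))) • ghat i, ⟨i, PathMon.triv v⟩⟩}

/-- No step is possible from the state. -/
def Halted (x : State A V r m) : Prop := ¬ ∃ y, Step ψ x y

/-- A run of the algorithm on the input `ghat`. If it reaches a state from which no step is
possible, it remains there. -/
def IsRun (ghat : Fin m → Fin r → A) (ρ : ℕ → State A V r m) : Prop :=
  ρ 0 = .start ⟨initialSet ψ ghat, ∅, none⟩ ∧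
    ∀ n, Step ψ (ρ n) (ρ (n + 1)) ∨ (Halted ψ (ρ n) ∧ ρ (n + 1) = ρ n)

end Signed

/-- The times at which a run enters the body of the while loop. -/
def loopRounds {A V : Type*} [Quiver V] {r m : ℕ} (ρ : ℕ → State A V r m) : Set ℕ :=
  {n | ∃ G L s f, ρ n = .loopHead G L ∧ ρ (n + 1) = .normalForm G L s f}

end SigF5

open SigF5

/-!
# The signature-based standard basis algorithm over quotients of path algebras

Elements of `M ∖ {0}` are compared through the monomials of `E` which are leading monomials of their
lifts. Cancellation of the leading terms of two lifts with the same signature `s` yields an element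
of smaller signature; this is the source of all induction on signatures. Lifts can be normalised
(`exists_hasSignature`) such that their signatures are standard, and the standard monomials of `E`
are well-ordered by admissibility (`isWF_isStd`).

**Correctness.** When the loop is left, each standard monomial `s` of `E` which is not a leading
monomial of `ker ev` is rewritable: it is `σ(g) · λ(c)` with `g ∈ G` and a small cofactor `c` of
`LM(g)`, and `poly(g) · c` is `s`-irreducible (`isRewritable_of_exit`). Indeed, the vertex at which
`s` starts is rewritable, as `G` contains an element with this signature. If an initial piece of `s`
is rewritable by `poly(g) · c` and shorter than `s`, then one multiplies `poly(g) · c` by the rest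
of `s`. Either this leads to a toppling, and hence to a critical pair of type T, or the result is
reducible, and hence leads to a critical pair of type S, unless `s` itself is rewritable. The
signatures of these pairs are longer initial pieces of `s`, and they are rewritable because the
condition of the loop fails (`exists_longer_isRewritable`). It follows by induction on `s` that each
element of `M ∖ {0}` of signature `s` is weakly reducible with respect to `G`
(`isWeaklyReducible_of_exit`).

**Invariants.** Top reductions with multiples of smaller signature do not change the signature of
the reduced element, so that a remainder zero exhibits its signature as a leading monomial of
`ker ev`.
A trivial signature `𝔢ᵢ 1_v` is removed from `G` only by a zero reduction, or if it is the signature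
of another element of `G` (`StateInvariant.step`).

**Termination.** A top reduction diminishes the leading monomial of the remainder. A removal or a
replacement in an interreduction diminishes the multiset of the leading monomials of `G` in the
Dershowitz–Manna order. Hence all steps but the entries of the loop diminish a well-founded rank
(`Step.rank_lt`), and an infinite run enters the loop infinitely often.
-/

namespace SigF5

open MulOpposite PathAlgebra

/-! ### Initial pieces of paths -/

namespace PathMon

variable {V : Type*} [Quiver V]

/-- The length of a path. -/
def length (a : PathMon V) : ℕ := a.path.length

theorem mul_eq_some_iff {a b c : PathMon V} :
    a.mul b = some c ↔ ∃ (u v w : V) (p : Quiver.Path u v) (q : Quiver.Path v w),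
      a = ⟨u, v, p⟩ ∧ b = ⟨v, w, q⟩ ∧ c = ⟨u, w, p.comp q⟩ := by
  constructor
  · intro h
    obtain ⟨a1, a2, p⟩ := a
    obtain ⟨b1, b2, q⟩ := b
    by_cases hh : a2 = b1
    · subst hh
      rw [mul_mk, Option.some.injEq] at h
      exact ⟨a1, a2, b2, p, q, rfl, rfl, h.symm⟩
    · rw [mul_of_ne hh] at h
      cases h
  · rintro ⟨u, v, w, p, q, rfl, rfl, rfl⟩
    exact mul_mk p q

theorem src_of_mul {a b c : PathMon V} (h : a.mul b = some c) : c.src = a.src := by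
  obtain ⟨u, v, w, p, q, rfl, rfl, rfl⟩ := mul_eq_some_iff.1 h
  rfl

theorem tgt_of_mul {a b c : PathMon V} (h : a.mul b = some c) : c.tgt = b.tgt := by
  obtain ⟨u, v, w, p, q, rfl, rfl, rfl⟩ := mul_eq_some_iff.1 h
  rfl

theorem tgt_eq_src_of_mul {a b c : PathMon V} (h : a.mul b = some c) : a.tgt = b.src := by
  obtain ⟨u, v, w, p, q, rfl, rfl, rfl⟩ := mul_eq_some_iff.1 h
  rfl

theorem exists_mul {a b : PathMon V} (h : a.tgt = b.src) : ∃ c, a.mul b = some c := by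
  obtain ⟨a1, a2, p⟩ := a
  obtain ⟨b1, b2, q⟩ := b
  subst h
  exact ⟨_, mul_mk p q⟩

theorem length_of_mul {a b c : PathMon V} (h : a.mul b = some c) :
    c.length = a.length + b.length := by
  obtain ⟨u, v, w, p, q, rfl, rfl, rfl⟩ := mul_eq_some_iff.1 h
  exact Quiver.Path.length_comp p q

theorem mul_right_cancel {a a' b c : PathMon V} (h : a.mul b = some c) (h' : a'.mul b = some c) :
    a = a' := by
  obtain ⟨u, v, w, p, q, rfl, rfl, rfl⟩ := mul_eq_some_iff.1 h
  obtain ⟨u', v', w', p', q', rfl, h2, h3⟩ := mul_eq_some_iff.1 h'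
  cases h2
  obtain ⟨rfl, -, h4⟩ := PathMon.mk.inj h3
  rw [heq_eq_eq, Quiver.Path.comp_inj_left] at h4
  rw [h4]

theorem mul_left_cancel {a b b' c : PathMon V} (h : a.mul b = some c) (h' : a.mul b' = some c) :
    b = b' := by
  obtain ⟨u, v, w, p, q, rfl, rfl, rfl⟩ := mul_eq_some_iff.1 h
  obtain ⟨u', v', w', p', q', h2, rfl, h3⟩ := mul_eq_some_iff.1 h'
  cases h2
  obtain ⟨-, rfl, h4⟩ := PathMon.mk.inj h3
  rw [heq_eq_eq, Quiver.Path.comp_inj_right] at h4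
  rw [h4]

theorem eq_triv_of_length {a : PathMon V} (h : a.length = 0) : a = triv a.src := by
  obtain ⟨u, v, p⟩ := a
  obtain rfl := Quiver.Path.eq_of_length_zero p h
  obtain rfl := Quiver.Path.eq_nil_of_length_zero p h
  rfl

theorem mul_tgt (a : PathMon V) : a.mul (triv a.tgt) = some a := mul_triv a _ rfl

theorem src_mul (a : PathMon V) : (triv a.src).mul a = some a := triv_mul _ a rfl

theorem eq_of_mul_of_length {a b e : PathMon V} (h : a.mul e = some b) (he : e.length = 0) :
    a = b := by
  have h1 : a.mul (triv e.src) = some b := by rwa [← eq_triv_of_length he]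
  exact Option.some.inj ((mul_triv a _ (tgt_eq_src_of_mul h1)).symm.trans h1)

theorem eq_of_mul_of_length' {a b e : PathMon V} (h : e.mul a = some b) (he : e.length = 0) :
    a = b := by
  have h1 : (triv e.src).mul a = some b := by rwa [← eq_triv_of_length he]
  exact Option.some.inj ((triv_mul _ a (tgt_eq_src_of_mul h1)).symm.trans h1)

/-- Associativity: a product of the form `(x y) z` can be rebracketed as `x (y z)`. -/
theorem mul_assoc_right {x y z xy w : PathMon V} (h : x.mul y = some xy) (h' : xy.mul z = some w) :
    ∃ yz, y.mul z = some yz ∧ x.mul yz = some w := by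
  have := mul_assoc_bind x y z
  rw [h, Option.bind_some, h'] at this
  exact Option.bind_eq_some_iff.1 this.symm

/-- Associativity: a product of the form `x (y z)` can be rebracketed as `(x y) z`. -/
theorem mul_assoc_left {x y z yz w : PathMon V} (h : y.mul z = some yz) (h' : x.mul yz = some w) :
    ∃ xy, x.mul y = some xy ∧ xy.mul z = some w := by
  have := mul_assoc_bind x y z
  rw [h, Option.bind_some, h'] at this
  exact Option.bind_eq_some_iff.1 this

theorem mul_comm_assoc {x y z xy yz w : PathMon V} (h : x.mul y = some xy) (h' : y.mul z = some yz)
    (hw : xy.mul z = some w) : x.mul yz = some w := by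
  obtain ⟨yz', h1, h2⟩ := mul_assoc_right h hw
  rw [h'] at h1
  cases h1
  exact h2

theorem mul_comm_assoc' {x y z xy yz w : PathMon V} (h : x.mul y = some xy)
    (h' : y.mul z = some yz) (hw : x.mul yz = some w) : xy.mul z = some w := by
  obtain ⟨xy', h1, h2⟩ := mul_assoc_left h' hw
  rw [h] at h1
  cases h1
  exact h2

/-- Of two factorisations of the same path, one refines the other. -/
theorem exists_of_comp_eq {t u u' w : V} (p : Quiver.Path t u) (p' : Quiver.Path t u')
    (q : Quiver.Path u w) (q' : Quiver.Path u' w) (h : p.comp q = p'.comp q') :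
    (∃ e : Quiver.Path u u', p.comp e = p' ∧ e.comp q' = q) ∨
      ∃ e : Quiver.Path u' u, p'.comp e = p ∧ e.comp q = q' := by
  induction q' with
  | nil => exact Or.inl ⟨q, h, rfl⟩
  | cons q' α ih =>
    cases q with
    | nil => exact Or.inr ⟨q'.cons α, h.symm, rfl⟩
    | cons q β =>
      rw [Quiver.Path.comp_cons, Quiver.Path.comp_cons] at h
      obtain rfl := Quiver.Path.obj_eq_of_cons_eq_cons h
      have h1 := eq_of_heq (Quiver.Path.heq_of_cons_eq_cons h)
      obtain rfl := eq_of_heq (Quiver.Path.hom_heq_of_cons_eq_cons h)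
      rcases ih q h1 with ⟨e, he, he'⟩ | ⟨e, he, he'⟩
      · exact Or.inl ⟨e, he, by rw [Quiver.Path.comp_cons, he']⟩
      · exact Or.inr ⟨e, he, by rw [Quiver.Path.comp_cons, he']⟩

/-- Two initial pieces of the same path are comparable. -/
theorem comparable {x a y b z : PathMon V} (h : x.mul a = some z) (h' : y.mul b = some z) :
    (∃ e, x.mul e = some y ∧ e.mul b = some a) ∨ ∃ e, y.mul e = some x ∧ e.mul a = some b := by
  obtain ⟨u, v, w, p, q, rfl, rfl, rfl⟩ := mul_eq_some_iff.1 h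
  obtain ⟨u', v', w', p', q', rfl, rfl, h3⟩ := mul_eq_some_iff.1 h'
  obtain ⟨rfl, rfl, h4⟩ := PathMon.mk.inj h3
  rcases exists_of_comp_eq p p' q q' (eq_of_heq h4) with ⟨e, rfl, rfl⟩ | ⟨e, rfl, rfl⟩
  · exact Or.inl ⟨⟨_, _, e⟩, mul_mk _ _, mul_mk _ _⟩
  · exact Or.inr ⟨⟨_, _, e⟩, mul_mk _ _, mul_mk _ _⟩

end PathMon

/-! ### Coefficients and leading monomials in the path algebra -/

namespace PathAlgebra

variable {K V : Type*} [Field K] [Quiver V]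

/-- The coefficient at `b`, as a linear map. -/
def coeffHom (K : Type*) [Field K] (b : PathMon V) : PathAlgebra K V →ₗ[K] K := Finsupp.lapply b

theorem coeff_eq (p : PathAlgebra K V) (b : PathMon V) : p.coeff b = coeffHom K b p := rfl

theorem coeff_ext {p q : PathAlgebra K V} (h : ∀ b, p.coeff b = q.coeff b) : p = q :=
  Finsupp.ext h

theorem coeff_sub (p q : PathAlgebra K V) (b : PathMon V) :
    (p - q).coeff b = p.coeff b - q.coeff b := by
  simp only [coeff_eq, map_sub]

theorem coeff_smul (x : K) (p : PathAlgebra K V) (b : PathMon V) :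
    (x • p).coeff b = x * p.coeff b := by
  simp only [coeff_eq, map_smul, smul_eq_mul]

theorem coeff_of_self (b : PathMon V) : (of K b).coeff b = 1 := Finsupp.single_eq_same

theorem coeff_of_ne {a b : PathMon V} (h : b ≠ a) : (of K a).coeff b = 0 :=
  Finsupp.single_eq_of_ne h

theorem finite_coeff_ne_zero (p : PathAlgebra K V) : {b | p.coeff b ≠ 0}.Finite :=
  Finsupp.hasFiniteSupport (show PathMon V →₀ K from p)

variable [Fintype V]

theorem coeff_mul_of {a c x : PathMon V} (h : a.mul c = some x) (p : PathAlgebra K V) :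
    (p * of K c).coeff x = p.coeff a := by
  have key : (coeffHom K x).comp (LinearMap.mulRight K (of K c)) = coeffHom K a := by
    refine hom_ext fun b => ?_
    rw [LinearMap.comp_apply, LinearMap.mulRight_apply, of_mul_of, ← coeff_eq, ← coeff_eq]
    by_cases hb : b = a
    · subst hb
      rw [h, coeff_of_self]
      exact coeff_of_self x
    · rw [coeff_of_ne (Ne.symm hb)]
      cases hm : b.mul c with
      | none => rfl
      | some y =>
        refine coeff_of_ne ?_
        rintro rfl
        exact hb (PathMon.mul_right_cancel hm h)
  exact congrArg (fun f => f p) key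

theorem coeff_of_mul {a c x : PathMon V} (h : c.mul a = some x) (p : PathAlgebra K V) :
    (of K c * p).coeff x = p.coeff a := by
  have key : (coeffHom K x).comp (LinearMap.mulLeft K (of K c)) = coeffHom K a := by
    refine hom_ext fun b => ?_
    rw [LinearMap.comp_apply, LinearMap.mulLeft_apply, of_mul_of, ← coeff_eq, ← coeff_eq]
    by_cases hb : b = a
    · subst hb
      rw [h, coeff_of_self]
      exact coeff_of_self x
    · rw [coeff_of_ne (Ne.symm hb)]
      cases hm : c.mul b with
      | none => rfl
      | some y =>
        refine coeff_of_ne ?_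
        rintro rfl
        exact hb (PathMon.mul_left_cancel hm h)
  exact congrArg (fun f => f p) key

theorem exists_of_coeff_mul_of_ne_zero {c x : PathMon V} {p : PathAlgebra K V}
    (h : (p * of K c).coeff x ≠ 0) : ∃ a, a.mul c = some x ∧ p.coeff a ≠ 0 := by
  by_cases hx : ∃ a : PathMon V, a.mul c = some x
  · obtain ⟨a, ha⟩ := hx
    exact ⟨a, ha, by rwa [coeff_mul_of ha] at h⟩
  · exfalso
    apply h
    have key : (coeffHom K x).comp (LinearMap.mulRight K (of K c)) = 0 := by
      refine hom_ext fun b => ?_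
      rw [LinearMap.comp_apply, LinearMap.mulRight_apply, of_mul_of, ← coeff_eq]
      cases hm : b.mul c with
      | none => rfl
      | some y =>
        refine coeff_of_ne ?_
        rintro rfl
        exact hx ⟨b, hm⟩
    exact congrArg (fun f => f p) key

theorem exists_of_coeff_of_mul_ne_zero {c x : PathMon V} {p : PathAlgebra K V}
    (h : (of K c * p).coeff x ≠ 0) : ∃ a, c.mul a = some x ∧ p.coeff a ≠ 0 := by
  by_cases hx : ∃ a : PathMon V, c.mul a = some x
  · obtain ⟨a, ha⟩ := hx
    exact ⟨a, ha, by rwa [coeff_of_mul ha] at h⟩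
  · exfalso
    apply h
    have key : (coeffHom K x).comp (LinearMap.mulLeft K (of K c)) = 0 := by
      refine hom_ext fun b => ?_
      rw [LinearMap.comp_apply, LinearMap.mulLeft_apply, of_mul_of, ← coeff_eq]
      cases hm : c.mul b with
      | none => rfl
      | some y =>
        refine coeff_of_ne ?_
        rintro rfl
        exact hx ⟨b, hm⟩
    exact congrArg (fun f => f p) key

end PathAlgebra

section Quotient

variable {K V A : Type*} [Field K] [Quiver V] [Fintype V] [LinearOrder (PathMon V)]
  [Ring A] [Algebra K A] {ψ : PathAlgebra K V →ₐ[K] A}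

theorem exists_isLeadP {p : PathAlgebra K V} (hp : p ≠ 0) : ∃ b, IsLeadP p b := by
  have hne : {b | p.coeff b ≠ 0}.Nonempty := by
    by_contra h
    refine hp (coeff_ext fun b => ?_)
    by_contra hb
    exact h ⟨b, hb⟩
  obtain ⟨b, hb, hmax⟩ := Set.exists_max_image _ id (finite_coeff_ne_zero p) hne
  exact ⟨b, hb, hmax⟩

theorem IsLeadP.mul_of (hP : IsMonomialOrdering V) {p : PathAlgebra K V} {b c d : PathMon V}
    (h : IsLeadP p b) (hd : b.mul c = some d) : IsLeadP (p * of K c) d := by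
  refine ⟨by rw [coeff_mul_of hd]; exact h.1, fun x hx => ?_⟩
  obtain ⟨a, ha, ha'⟩ := exists_of_coeff_mul_of_ne_zero hx
  rcases (h.2 a ha').eq_or_lt with rfl | hlt
  · rw [ha] at hd
    cases hd
    exact le_rfl
  · exact (hP.mul_right _ _ _ _ _ hlt hd ha).le

theorem IsLeadP.of_mul (hP : IsMonomialOrdering V) {p : PathAlgebra K V} {b c d : PathMon V}
    (h : IsLeadP p b) (hd : c.mul b = some d) : IsLeadP (of K c * p) d := by
  refine ⟨by rw [coeff_of_mul hd]; exact h.1, fun x hx => ?_⟩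
  obtain ⟨a, ha, ha'⟩ := exists_of_coeff_of_mul_ne_zero hx
  rcases (h.2 a ha').eq_or_lt with rfl | hlt
  · rw [ha] at hd
    cases hd
    exact le_rfl
  · exact (hP.mul_left _ _ _ _ _ hlt hd ha).le

/-- Initial pieces of standard monomials are standard. -/
theorem IsStd.left (hP : IsMonomialOrdering V) {b c d : PathMon V} (h : b.mul c = some d)
    (hd : IsStd ψ d) : IsStd ψ b := by
  rintro ⟨p, hp, hb⟩
  exact hd ⟨p * of K c, by rw [map_mul, hp, zero_mul], hb.mul_of hP h⟩

/-- Final pieces of standard monomials are standard. -/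
theorem IsStd.right (hP : IsMonomialOrdering V) {b c d : PathMon V} (h : b.mul c = some d)
    (hd : IsStd ψ d) : IsStd ψ c := by
  rintro ⟨p, hp, hb⟩
  exact hd ⟨of K b * p, by rw [map_mul, hp, mul_zero], hb.of_mul hP h⟩

theorem eq_zero_of_isStd {p : PathAlgebra K V} (hp : ∀ b, p.coeff b ≠ 0 → IsStd ψ b)
    (h : ψ p = 0) : p = 0 := by
  by_contra hne
  obtain ⟨b, hb⟩ := exists_isLeadP hne
  exact hp b hb.1 ⟨p, h, hb⟩

/-- The lift of a combination of monomials of `A` to the path algebra. -/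
noncomputable def stdLift (ψ : PathAlgebra K V →ₐ[K] A) :
    (StdMon ψ →₀ K) →ₗ[K] PathAlgebra K V :=
  Finsupp.lmapDomain K K Subtype.val

theorem coeff_stdLift (l : StdMon ψ →₀ K) (b : StdMon ψ) : (stdLift ψ l).coeff b.1 = l b :=
  Finsupp.mapDomain_apply Subtype.val_injective l b

theorem isStd_of_coeff_stdLift {l : StdMon ψ →₀ K} {b : PathMon V}
    (h : (stdLift ψ l).coeff b ≠ 0) : IsStd ψ b := by
  by_contra hb
  refine h (Finsupp.mapDomain_of_notMem_range l b ?_)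
  rintro ⟨x, rfl⟩
  exact hb x.2

theorem map_stdLift (l : StdMon ψ →₀ K) :
    ψ (stdLift ψ l) = Finsupp.linearCombination K (StdMon.val ψ) l := by
  have key : ψ.toLinearMap.comp (stdLift ψ) = Finsupp.linearCombination K (StdMon.val ψ) := by
    refine Finsupp.lhom_ext' fun b => LinearMap.ext_ring ?_
    change ψ (stdLift ψ (Finsupp.single b 1)) = Finsupp.linearCombination K _ (Finsupp.single b 1)
    rw [Finsupp.linearCombination_single, one_smul]
    exact congrArg ψ Finsupp.mapDomain_single
  exact congrArg (fun f => f l) key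

theorem linearIndependent_val : LinearIndependent K (StdMon.val ψ) := by
  rw [linearIndependent_iff]
  intro l hl
  rw [← map_stdLift] at hl
  have h0 := eq_zero_of_isStd (fun b hb => isStd_of_coeff_stdLift hb) hl
  ext b
  rw [← coeff_stdLift, h0]
  rfl

/-- The basis of `A` formed by its monomials. -/
noncomputable def stdBasis (hb : HasPreferredBasis ψ) : Module.Basis (StdMon ψ) K A :=
  Module.Basis.mk linearIndependent_val (top_le_iff.2 hb)

theorem stdBasis_apply (hb : HasPreferredBasis ψ) (b : StdMon ψ) :
    stdBasis hb b = StdMon.val ψ b := Module.Basis.mk_apply _ _ b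

theorem map_stdLift_repr (hb : HasPreferredBasis ψ) (a : A) :
    ψ (stdLift ψ ((stdBasis hb).repr a)) = a := by
  rw [map_stdLift]
  have h := (stdBasis hb).linearCombination_repr a
  rwa [show ⇑(stdBasis hb) = StdMon.val ψ from funext (stdBasis_apply hb)] at h

theorem eq_stdLift_repr (hb : HasPreferredBasis ψ) {p : PathAlgebra K V}
    (hp : ∀ b, p.coeff b ≠ 0 → IsStd ψ b) : p = stdLift ψ ((stdBasis hb).repr (ψ p)) := by
  rw [← sub_eq_zero]
  refine eq_zero_of_isStd (ψ := ψ) (fun b h => ?_) ?_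
  · by_contra hn
    have h1 : p.coeff b = 0 := by
      by_contra h1
      exact hn (hp b h1)
    have h2 : (stdLift ψ ((stdBasis hb).repr (ψ p))).coeff b = 0 := by
      by_contra h2
      exact hn (isStd_of_coeff_stdLift h2)
    rw [coeff_sub, h1, h2, sub_zero] at h
    exact h rfl
  · rw [map_sub, map_stdLift_repr, sub_self]

/-- The normal form of an element of the path algebra modulo `ker ψ` does not exceed it: each
monomial of the normal form is bounded by a monomial of the given element. -/
theorem exists_le_of_coeff_stdLift (hb : HasPreferredBasis ψ) {p : PathAlgebra K V} {x : PathMon V}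
    (hx : (stdLift ψ ((stdBasis hb).repr (ψ p))).coeff x ≠ 0) : ∃ b, p.coeff b ≠ 0 ∧ x ≤ b := by
  set q := stdLift ψ ((stdBasis hb).repr (ψ p)) with hq
  have hq0 : q ≠ 0 := by
    intro h0
    rw [h0] at hx
    exact hx rfl
  obtain ⟨y, hy⟩ := exists_isLeadP hq0
  by_contra! hcon
  -- otherwise the leading monomial of the normal form is the one of an element of the kernel
  refine isStd_of_coeff_stdLift hy.1 ⟨q - p, by rw [map_sub, map_stdLift_repr, sub_self], ?_, ?_⟩
  · have : p.coeff y = 0 := by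
      by_contra h
      exact absurd (hy.2 x hx) (not_le.2 (hcon y h))
    rw [coeff_sub, this, sub_zero]
    exact hy.1
  · intro b' hb'
    rw [coeff_sub] at hb'
    by_cases h : q.coeff b' = 0
    · have : p.coeff b' ≠ 0 := by
        intro h1
        rw [h, h1, sub_zero] at hb'
        exact hb' rfl
      exact (hcon b' this).le.trans (hy.2 x hx)
    · exact hy.2 b' h

theorem wellFoundedLT_stdMon (h : IsAdmissible ψ) : WellFoundedLT (StdMon ψ) := by
  refine ⟨wellFounded_iff_isEmpty_descending_chain.2 ⟨fun f => h ⟨f.1, f.2⟩⟩⟩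

theorem val_mul_val {b c d : StdMon ψ} (h : b.1.mul c.1 = some d.1) :
    StdMon.val ψ b * StdMon.val ψ c = StdMon.val ψ d := by
  unfold StdMon.val
  rw [← map_mul, of_mul_of, h]
  rfl

theorem exists_isLeadA (hb : HasPreferredBasis ψ) {a : A} {x : StdMon ψ}
    (hx : (stdBasis hb).repr a x ≠ 0) : ∃ l, IsLeadA ψ a l ∧ x ≤ l := by
  set q := stdLift ψ ((stdBasis hb).repr a) with hq
  have hx' : q.coeff x.1 ≠ 0 := by rwa [hq, coeff_stdLift]
  have hq0 : q ≠ 0 := by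
    intro h0
    rw [h0] at hx'
    exact hx' rfl
  obtain ⟨y, hy⟩ := exists_isLeadP hq0
  have hs : ∀ b', q.coeff b' ≠ 0 → IsStd ψ b' := fun b' hb' => isStd_of_coeff_stdLift hb'
  exact ⟨⟨y, hs y hy.1⟩, ⟨q, hs, map_stdLift_repr hb a, hy⟩, hy.2 _ hx'⟩

theorem IsSmallCofactor.left (hP : IsMonomialOrdering V) {b c c' : StdMon ψ}
    (h : IsSmallCofactor ψ b c) (hc : StrictDvd ψ c' c) : IsSmallCofactor ψ b c' := by
  obtain ⟨d, hd⟩ := h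
  obtain ⟨e, he⟩ := hc
  obtain ⟨x, hx, hx'⟩ := PathMon.mul_assoc_left he hd
  exact ⟨⟨x, d.2.left hP hx'⟩, hx⟩

/-- A standard monomial that is not a small cofactor of `b` has an initial piece which is the
cofactor of a minimal toppling of `b`. -/
theorem exists_isMinTopplingCofactor {b c : StdMon ψ} (h : ¬ IsSmallCofactor ψ b c) :
    ∃ c₁ : StdMon ψ, StrictDvd ψ c₁ c ∧ IsMinTopplingCofactor ψ b c₁ := by
  have hne : {c₁ : StdMon ψ | StrictDvd ψ c₁ c ∧ ¬ IsSmallCofactor ψ b c₁}.Nonempty :=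
    ⟨c, ⟨_, PathMon.mul_tgt c.1⟩, h⟩
  obtain ⟨c₁, ⟨hc₁, hc₁'⟩, hmin⟩ := exists_minimalFor_of_wellFoundedLT
    (fun x : StdMon ψ => StrictDvd ψ x c ∧ ¬ IsSmallCofactor ψ b x) (fun x => x.1.length) hne
  refine ⟨c₁, hc₁, hc₁', fun c' hc' hne' => ?_⟩
  by_contra hns
  obtain ⟨d, hd⟩ := hc₁
  obtain ⟨e, he⟩ := hc'
  obtain ⟨x, -, hx'⟩ := PathMon.mul_assoc_right he hd
  have hle := hmin (j := c') ⟨⟨x, hx'⟩, hns⟩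
    (by dsimp only; rw [PathMon.length_of_mul he]; exact Nat.le_add_right _ _)
  dsimp only at hle
  rw [PathMon.length_of_mul he] at hle
  have he0 : e.length = 0 := by omega
  exact hne' (Subtype.ext (PathMon.eq_of_mul_of_length he he0))

end Quotient

/-! ### Leading terms in `F` -/

section Leading

variable {K V A : Type*} [Field K] [Quiver V] [Fintype V] [LinearOrder (PathMon V)]
  [Ring A] [Algebra K A] {ψ : PathAlgebra K V →ₐ[K] A} {r m : ℕ}

/-- The coefficient of `f ∈ F` at the monomial `u`. -/
noncomputable def coefF (hb : HasPreferredBasis ψ) (f : Fin r → A) (u : FMon ψ r) : K :=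
  (stdBasis hb).repr (f u.idx) u.mon

theorem coefF_sub_smul (hb : HasPreferredBasis ψ) (f g : Fin r → A) (k : K) (u : FMon ψ r) :
    coefF hb (f - k • g) u = coefF hb f u - k * coefF hb g u := by
  simp [coefF]

theorem coefF_zero (hb : HasPreferredBasis ψ) (u : FMon ψ r) : coefF hb 0 u = 0 := by
  simp [coefF]

theorem eq_zero_of_coefF (hb : HasPreferredBasis ψ) {f : Fin r → A}
    (h : ∀ u, coefF hb f u = 0) : f = 0 := by
  ext j
  refine (stdBasis hb).repr.injective ?_
  ext b
  simpa [coefF] using h ⟨j, b⟩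

theorem finite_coefF_ne_zero (hb : HasPreferredBasis ψ) (f : Fin r → A) :
    {u : FMon ψ r | coefF hb f u ≠ 0}.Finite := by
  refine Set.Finite.subset (Set.finite_iUnion fun j : Fin r =>
    (Finsupp.hasFiniteSupport ((stdBasis hb).repr (f j))).image (ModMon.mk j)) ?_
  rintro ⟨j, b⟩ hu
  exact Set.mem_iUnion.2 ⟨j, b, hu, rfl⟩

theorem coefF_of_lift (hb : HasPreferredBasis ψ) {f : Fin r → A} {q : Fin r → PathAlgebra K V}
    (hq : ∀ j b, (q j).coeff b ≠ 0 → IsStd ψ b) (hf : ∀ j, ψ (q j) = f j) (u : FMon ψ r) :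
    coefF hb f u = (q u.idx).coeff u.mon.1 := by
  rw [eq_stdLift_repr hb (hq u.idx), coeff_stdLift, hf]
  rfl

theorem isLT_iff [LinearOrder (FMon ψ r)] (hb : HasPreferredBasis ψ) {f : Fin r → A}
    {t : FMon ψ r} {a : K} :
    IsLT ψ f t a ↔ coefF hb f t = a ∧ a ≠ 0 ∧ ∀ u, coefF hb f u ≠ 0 → u ≤ t := by
  constructor
  · rintro ⟨q, hq, hf, h⟩
    simp only [coefF_of_lift hb hq hf]
    exact h
  · intro h
    refine ⟨fun j => stdLift ψ ((stdBasis hb).repr (f j)), fun j b => isStd_of_coeff_stdLift,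
      fun j => map_stdLift_repr hb _, ?_⟩
    simp only [coeff_stdLift]
    exact h

theorem isLM_iff [LinearOrder (FMon ψ r)] (hb : HasPreferredBasis ψ) {f : Fin r → A}
    {t : FMon ψ r} :
    IsLM ψ f t ↔ coefF hb f t ≠ 0 ∧ ∀ u, coefF hb f u ≠ 0 → u ≤ t := by
  simp only [IsLM, isLT_iff hb]
  exact ⟨fun ⟨a, h1, h2, h3⟩ => ⟨h1 ▸ h2, h3⟩, fun h => ⟨_, rfl, h⟩⟩

theorem exists_isLM [LinearOrder (FMon ψ r)] (hb : HasPreferredBasis ψ) {f : Fin r → A}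
    (hf : f ≠ 0) : ∃ t, IsLM ψ f t := by
  have hne : {u | coefF hb f u ≠ 0}.Nonempty := by
    by_contra h
    refine hf (eq_zero_of_coefF hb fun u => ?_)
    by_contra hu
    exact h ⟨u, hu⟩
  obtain ⟨t, ht, hmax⟩ := Set.exists_max_image _ id (finite_coefF_ne_zero hb f) hne
  exact ⟨t, (isLM_iff hb).2 ⟨ht, hmax⟩⟩

theorem IsLM.unique [LinearOrder (FMon ψ r)] (hb : HasPreferredBasis ψ) {f : Fin r → A}
    {t t' : FMon ψ r} (h : IsLM ψ f t) (h' : IsLM ψ f t') : t = t' := by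
  rw [isLM_iff hb] at h h'
  exact le_antisymm (h'.2 _ h.1) (h.2 _ h'.1)

theorem IsLM.ne_zero [LinearOrder (FMon ψ r)] (hb : HasPreferredBasis ψ) {f : Fin r → A}
    {t : FMon ψ r} (h : IsLM ψ f t) : f ≠ 0 := by
  rintro rfl
  exact ((isLM_iff hb).1 h).1 (coefF_zero hb t)

theorem ModMon.eq_mk {n : ℕ} {S : Type*} {u : ModMon n S} {j : Fin n} (h : u.idx = j) :
    u = ⟨j, u.mon⟩ := by
  subst h
  rfl

theorem coefF_op_smul (hb : HasPreferredBasis ψ) (f : Fin r → A) (c : A) (j : Fin r)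
    (x : StdMon ψ) :
    coefF hb (op c • f) ⟨j, x⟩ =
      ((stdBasis hb).repr (f j)).sum fun b k => k * (stdBasis hb).repr (StdMon.val ψ b * c) x := by
  unfold coefF
  have h1 : (op c • f) j = f j * c := rfl
  have h2 : f j * c =
      ((stdBasis hb).repr (f j)).sum fun b k => k • (StdMon.val ψ b * c) := by
    conv_lhs => rw [← (stdBasis hb).linearCombination_repr (f j)]
    simp only [Finsupp.linearCombination_apply, Finsupp.sum, Finset.sum_mul, stdBasis_apply,
      smul_mul_assoc]
  change (stdBasis hb).repr ((op c • f) j) x = _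
  rw [h1]
  conv_lhs => rw [h2]
  simp only [Finsupp.sum, map_sum, Finsupp.finsetSum_apply, map_smul, Finsupp.smul_apply,
    smul_eq_mul]

/-- Small cofactors are compatible with leading terms: multiplication by a small cofactor of the
leading monomial just multiplies the leading monomial. -/
theorem IsLT.mul [LinearOrder (FMon ψ r)] (hb : HasPreferredBasis ψ) (hF : IsCompatibleF ψ r)
    {f : Fin r → A} {u t : FMon ψ r} {a : K} {c : StdMon ψ} (h : IsLT ψ f u a)
    (hut : u.MulEq c t) : IsLT ψ (op (StdMon.val ψ c) • f) t a := by
  rw [isLT_iff hb] at h ⊢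
  obtain ⟨h1, h2, h3⟩ := h
  have hval : StdMon.val ψ u.mon * StdMon.val ψ c = stdBasis hb t.mon := by
    rw [stdBasis_apply]
    exact val_mul_val hut.2
  -- the terms of `f` below the leading one contribute to monomials below `t` only
  have hlow : ∀ (j : Fin r) (b x : StdMon ψ), (⟨j, b⟩ : FMon ψ r) < u →
      (stdBasis hb).repr (StdMon.val ψ b * StdMon.val ψ c) x ≠ 0 → (⟨j, x⟩ : FMon ψ r) < t := by
    intro j b x hlt hx
    obtain ⟨l, hl, hxl⟩ := exists_isLeadA hb hx
    have h4 := hF.mul u ⟨j, b⟩ t c l hlt hut hl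
    rcases hxl.eq_or_lt with rfl | hxl
    · exact h4
    · exact (hF.of_lt j l x hxl).trans h4
  have hle : ∀ (j : Fin r) (b : StdMon ψ), (stdBasis hb).repr (f j) b ≠ 0 →
      (⟨j, b⟩ : FMon ψ r) ≤ u := fun j b hjb => h3 ⟨j, b⟩ hjb
  refine ⟨?_, h2, ?_⟩
  · rw [ModMon.eq_mk hut.1, coefF_op_smul, Finsupp.sum, Finset.sum_eq_single u.mon]
    · rw [hval, Module.Basis.repr_self, Finsupp.single_eq_same, mul_one]
      exact h1
    · intro b hbs hbu
      by_cases h0 : (stdBasis hb).repr (StdMon.val ψ b * StdMon.val ψ c) t.mon = 0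
      · rw [h0, mul_zero]
      · exfalso
        have hlt : (⟨u.idx, b⟩ : FMon ψ r) < u := by
          refine lt_of_le_of_ne (hle _ _ (Finsupp.mem_support_iff.1 hbs)) ?_
          intro he
          exact hbu (congrArg ModMon.mon he)
        have := hlow _ _ _ hlt h0
        rw [← ModMon.eq_mk hut.1] at this
        exact lt_irrefl _ this
    · intro hbs
      rw [Finsupp.notMem_support_iff.1 hbs, zero_mul]
  · rintro ⟨j, x⟩ hx
    rw [coefF_op_smul] at hx
    obtain ⟨b, hbs, hb0⟩ := Finset.exists_ne_zero_of_sum_ne_zero hx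
    have hbf : (stdBasis hb).repr (f j) b ≠ 0 := Finsupp.mem_support_iff.1 hbs
    have hbx := right_ne_zero_of_mul hb0
    rcases (hle j b hbf).eq_or_lt with he | hlt
    · subst he
      dsimp only at hval
      rw [hval, Module.Basis.repr_self] at hbx
      have : x = t.mon := by
        by_contra hne
        exact hbx (Finsupp.single_eq_of_ne hne)
      subst this
      exact (ModMon.eq_mk hut.1).ge
    · exact (hlow j b x hlt hbx).le

theorem IsLM.mul [LinearOrder (FMon ψ r)] (hb : HasPreferredBasis ψ) (hF : IsCompatibleF ψ r)
    {f : Fin r → A} {u t : FMon ψ r} {c : StdMon ψ} (h : IsLM ψ f u)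
    (hut : u.MulEq c t) : IsLM ψ (op (StdMon.val ψ c) • f) t := by
  obtain ⟨a, ha⟩ := h
  exact ⟨a, ha.mul hb hF hut⟩

/-- A top reduction cancels the leading term. -/
theorem lt_of_coefF_sub_ne_zero [LinearOrder (FMon ψ r)] (hb : HasPreferredBasis ψ)
    {f g : Fin r → A} {t : FMon ψ r} {a a' : K} (hf : IsLT ψ f t a) (hg : IsLT ψ g t a')
    {u : FMon ψ r} (hu : coefF hb (f - (a / a') • g) u ≠ 0) : u < t := by
  rw [isLT_iff hb] at hf hg
  rw [coefF_sub_smul] at hu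
  refine lt_of_le_of_ne ?_ ?_
  · by_contra h
    have h1 : coefF hb f u = 0 := by
      by_contra h1
      exact h (hf.2.2 u h1)
    have h2 : coefF hb g u = 0 := by
      by_contra h2
      exact h (hg.2.2 u h2)
    rw [h1, h2, mul_zero, sub_zero] at hu
    exact hu rfl
  · rintro rfl
    rw [hf.1, hg.1, div_mul_cancel₀ _ hg.2.1, sub_self] at hu
    exact hu rfl

/-- The leading monomial of `f ∈ F`, where `⊥` is the leading monomial of `0`. -/
noncomputable def lmBot [LinearOrder (FMon ψ r)] (hb : HasPreferredBasis ψ) (f : Fin r → A) :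
    WithBot (FMon ψ r) := (finite_coefF_ne_zero hb f).toFinset.max

theorem lmBot_lt [LinearOrder (FMon ψ r)] (hb : HasPreferredBasis ψ) {f : Fin r → A}
    {t : FMon ψ r} (h : ∀ u, coefF hb f u ≠ 0 → u < t) : lmBot hb f < t := by
  refine (Finset.sup_lt_iff (WithBot.bot_lt_coe t)).2 fun u hu => ?_
  exact WithBot.coe_lt_coe.2 (h u (by simpa using hu))

theorem IsLM.lmBot_eq [LinearOrder (FMon ψ r)] (hb : HasPreferredBasis ψ) {f : Fin r → A}
    {t : FMon ψ r} (h : IsLM ψ f t) : lmBot hb f = t := by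
  rw [isLM_iff hb] at h
  refine le_antisymm (Finset.max_le fun u hu => ?_) (Finset.le_max (by simpa using h.1))
  exact WithBot.coe_le_coe.2 (h.2 u (by simpa using hu))

theorem lmBot_sub_lt [LinearOrder (FMon ψ r)] (hb : HasPreferredBasis ψ)
    {f g : Fin r → A} {t : FMon ψ r} {a a' : K} (hf : IsLT ψ f t a) (hg : IsLT ψ g t a') :
    lmBot hb (f - (a / a') • g) < lmBot hb f := by
  rw [IsLM.lmBot_eq hb ⟨a, hf⟩]
  exact lmBot_lt hb fun u hu => lt_of_coefF_sub_ne_zero hb hf hg hu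

/-- The difference of two elements with distinct leading monomials has the greater of the two as
its leading monomial. -/
theorem IsLM.sub_smul [LinearOrder (FMon ψ r)] (hb : HasPreferredBasis ψ)
    {f g : Fin r → A} {t t' : FMon ψ r} {k : K} (hk : k ≠ 0) (hf : IsLM ψ f t) (hg : IsLM ψ g t')
    (h : t ≠ t') : IsLM ψ (f - k • g) (max t t') := by
  rw [isLM_iff hb] at hf hg ⊢
  simp only [coefF_sub_smul]
  constructor
  · rcases h.lt_or_gt with hlt | hlt
    · rw [max_eq_right hlt.le]
      have : coefF hb f t' = 0 := by
        by_contra h0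
        exact absurd (hf.2 _ h0) (not_le.2 hlt)
      rw [this, zero_sub]
      exact neg_ne_zero.2 (mul_ne_zero hk hg.1)
    · rw [max_eq_left hlt.le]
      have : coefF hb g t = 0 := by
        by_contra h0
        exact absurd (hg.2 _ h0) (not_le.2 hlt)
      rw [this, mul_zero, sub_zero]
      exact hf.1
  · intro u hu
    by_cases h0 : coefF hb f u = 0
    · refine le_max_of_le_right (hg.2 u fun h1 => hu ?_)
      rw [h0, h1, mul_zero, sub_zero]
    · exact le_max_of_le_left (hf.2 u h0)

/-- Multiplication by `1_w` picks out the monomials that end at `w`. -/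
theorem coefF_triv (hb : HasPreferredBasis ψ) (f : Fin r → A) (w : V)
    (u : FMon ψ r) :
    (u.mon.1.tgt = w → coefF hb (op (ψ (of K (PathMon.triv w))) • f) u = coefF hb f u) ∧
    (u.mon.1.tgt ≠ w → coefF hb (op (ψ (of K (PathMon.triv w))) • f) u = 0) := by
  have key := coefF_of_lift hb (f := op (ψ (of K (PathMon.triv w))) • f)
    (q := fun j => stdLift ψ ((stdBasis hb).repr (f j)) * of K (PathMon.triv w))
    (by
      intro j b h
      obtain ⟨a, ha, ha'⟩ := exists_of_coeff_mul_of_ne_zero h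
      have : a = b := by
        have h1 := PathMon.mul_triv a w (PathMon.tgt_eq_src_of_mul ha)
        rw [h1] at ha
        exact Option.some.inj ha
      rw [← this]
      exact isStd_of_coeff_stdLift ha')
    (by
      intro j
      rw [map_mul, map_stdLift_repr]
      rfl) u
  constructor
  · intro h
    rw [key, coeff_mul_of (PathMon.mul_triv u.mon.1 w h), coeff_stdLift]
    rfl
  · intro h
    rw [key]
    by_contra h0
    obtain ⟨a, ha, -⟩ := exists_of_coeff_mul_of_ne_zero h0
    exact h (PathMon.tgt_of_mul ha)

/-- A total order on the monomials of a free module is well-founded on a set if it is so on the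
monomials of this set with a given index. -/
theorem ModMon.isWF {n : ℕ} {S : Type*} [LinearOrder (ModMon n S)] {s : Set (ModMon n S)}
    (h : ∀ i, {u | u ∈ s ∧ u.idx = i}.IsWF) : s.IsWF := by
  have : s = ⋃ i ∈ (Finset.univ : Finset (Fin n)), {u | u ∈ s ∧ u.idx = i} := by
    ext u
    simp
  rw [this]
  exact (Finset.isWF_bUnion _).2 fun i _ => h i

theorem isWF_of_strictMono {α β : Type*} [LinearOrder α] [WellFoundedLT α] [LinearOrder β]
    {f : α → β} (hf : StrictMono f) {s : Set β} (hs : s ⊆ Set.range f) : s.IsWF := by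
  have h1 : (Set.range f).IsPWO := by
    rw [← Set.image_univ]
    exact (Set.isPWO_of_wellQuasiOrderedLE Set.univ).image_of_monotone hf.monotone
  exact (h1.mono hs).isWF

theorem wellFoundedLT_fMon [LinearOrder (FMon ψ r)] (hadm : IsAdmissible ψ)
    (hF : IsCompatibleF ψ r) : WellFoundedLT (FMon ψ r) := by
  have := wellFoundedLT_stdMon hadm
  rw [← Set.isWF_univ_iff]
  refine ModMon.isWF fun i => isWF_of_strictMono (f := ModMon.mk i)
    (fun b₁ b₂ h => hF.of_lt i b₂ b₁ h) ?_
  rintro ⟨j, b⟩ ⟨-, h⟩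
  exact ⟨b, by subst h; rfl⟩

theorem isWF_isStd [LinearOrder (EMon V m)] (hadm : IsAdmissible ψ) (hE : IsCompatibleE V m) :
    {s : EMon V m | IsStd ψ s.mon}.IsWF := by
  have := wellFoundedLT_stdMon hadm
  refine ModMon.isWF fun i => isWF_of_strictMono (f := fun b : StdMon ψ => (⟨i, b.1⟩ : EMon V m))
    (fun b₁ b₂ h => hE.of_lt i b₂ b₁ h) ?_
  rintro ⟨j, b⟩ ⟨hb, h⟩
  exact ⟨⟨b, hb⟩, by subst h; rfl⟩

end Leading

/-! ### Multiplication of module monomials by paths -/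

namespace EMon

variable {V : Type*} [Quiver V] {m : ℕ}

theorem MulEq.unique {u : EMon V m} {d : PathMon V} {s s' : EMon V m} (h : u.MulEq d s)
    (h' : u.MulEq d s') : s = s' := by
  obtain ⟨h1, h2⟩ := h
  obtain ⟨h1', h2'⟩ := h'
  rw [h2] at h2'
  exact ModMon.ext (h1.trans h1'.symm) (Option.some.inj h2')

theorem mulEq_triv (u : EMon V m) {w : V} (h : u.mon.tgt = w) : u.MulEq (PathMon.triv w) u :=
  ⟨rfl, PathMon.mul_triv _ _ h⟩

theorem exists_mulEq (u : EMon V m) {d : PathMon V} (h : u.mon.tgt = d.src) :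
    ∃ s, u.MulEq d s := by
  obtain ⟨c, hc⟩ := PathMon.exists_mul h
  exact ⟨⟨u.idx, c⟩, rfl, hc⟩

theorem MulEq.trans {u s t : EMon V m} {a b c : PathMon V} (h : u.MulEq a s) (h' : s.MulEq b t)
    (hab : a.mul b = some c) : u.MulEq c t :=
  ⟨h'.1.trans h.1, PathMon.mul_comm_assoc h.2 hab h'.2⟩

theorem MulEq.assoc {u s t : EMon V m} {a b c : PathMon V} (h : u.MulEq a s) (h' : u.MulEq c t)
    (hab : a.mul b = some c) : s.MulEq b t :=
  ⟨h'.1.trans h.1.symm, PathMon.mul_comm_assoc' h.2 hab h'.2⟩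

theorem MulEq.split {u t : EMon V m} {a b c : PathMon V} (h : u.MulEq c t)
    (hab : a.mul b = some c) : ∃ s, u.MulEq a s ∧ s.MulEq b t := by
  obtain ⟨s, hs⟩ := u.exists_mulEq (d := a)
    ((PathMon.tgt_eq_src_of_mul h.2).trans (PathMon.src_of_mul hab))
  exact ⟨s, hs, hs.assoc h hab⟩

/-- Multiplication by a path can be cancelled in strict inequalities. -/
theorem lt_of_mulEq [LinearOrder (PathMon V)] [LinearOrder (EMon V m)] (hE : IsCompatibleE V m)
    {u₁ u₂ t₁ t₂ : EMon V m} {b : PathMon V} (h₁ : u₁.MulEq b t₁) (h₂ : u₂.MulEq b t₂)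
    (h : t₂ < t₁) : u₂ < u₁ := by
  rcases lt_trichotomy u₁ u₂ with hlt | rfl | hlt
  · exact absurd (hE.mul _ _ _ _ _ hlt h₂ h₁) h.not_gt
  · rw [h₁.unique h₂] at h
    exact absurd h (lt_irrefl _)
  · exact hlt

end EMon

/-! ### Signatures -/

section Signature

variable {K V A : Type*} [Field K] [Quiver V] [Fintype V]
  [Ring A] [Algebra K A] {ψ : PathAlgebra K V →ₐ[K] A} {r m : ℕ} {ghat : Fin m → Fin r → A}

theorem ev_apply (p : Fin m → PathAlgebra K V) (j : Fin r) :
    ev ψ ghat p j = ∑ i, ghat i j * ψ (p i) := by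
  simp [ev]

theorem ev_sub_smul (p q : Fin m → PathAlgebra K V) (k : K) :
    ev ψ ghat (p - k • q) = ev ψ ghat p - k • ev ψ ghat q := by
  ext j
  simp [ev_apply, mul_sub, Finset.sum_sub_distrib, Finset.smul_sum]

theorem ev_mul (p : Fin m → PathAlgebra K V) (c : PathAlgebra K V) :
    ev ψ ghat (fun i => p i * c) = op (ψ c) • ev ψ ghat p := by
  ext j
  simp [ev_apply, Finset.sum_mul, mul_assoc]

theorem ev_congr {p q : Fin m → PathAlgebra K V} (h : ∀ i, ψ (p i) = ψ (q i)) :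
    ev ψ ghat p = ev ψ ghat q := by
  simp only [ev, h]

theorem ev_single [DecidableEq (Fin m)] (i : Fin m) (c : PathAlgebra K V) :
    ev ψ ghat (Pi.single i c) = op (ψ c) • ghat i := by
  rw [ev, Finset.sum_eq_single i]
  · rw [Pi.single_eq_same]
  · intro j _ hj
    rw [Pi.single_eq_of_ne hj, map_zero, op_zero, zero_smul]
  · intro h
    exact absurd (Finset.mem_univ i) h

theorem ev_mem_span (p : Fin m → PathAlgebra K V) :
    ev ψ ghat p ∈ Submodule.span Aᵐᵒᵖ (Set.range ghat) :=
  Submodule.sum_mem _ fun i _ =>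
    Submodule.smul_mem _ _ (Submodule.subset_span (Set.mem_range_self i))

variable [LinearOrder (EMon V m)]

theorem exists_isLeadE {p : Fin m → PathAlgebra K V} (hp : p ≠ 0) : ∃ s, IsLeadE p s := by
  have hfin : {u : EMon V m | (p u.idx).coeff u.mon ≠ 0}.Finite := by
    refine Set.Finite.subset (Set.finite_iUnion fun j : Fin m =>
      (finite_coeff_ne_zero (p j)).image (ModMon.mk j)) ?_
    rintro ⟨j, b⟩ hu
    exact Set.mem_iUnion.2 ⟨j, b, hu, rfl⟩
  have hne : {u : EMon V m | (p u.idx).coeff u.mon ≠ 0}.Nonempty := by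
    by_contra h
    refine hp (funext fun j => coeff_ext fun b => ?_)
    by_contra hb
    exact h ⟨⟨j, b⟩, hb⟩
  obtain ⟨s, hs, hmax⟩ := Set.exists_max_image _ id hfin hne
  exact ⟨s, hs, hmax⟩

theorem IsLeadE.sub_smul {p q : Fin m → PathAlgebra K V} {s s' : EMon V m} (hp : IsLeadE p s)
    (hq : IsLeadE q s') (h : s' < s) (k : K) : IsLeadE (p - k • q) s := by
  have hc : ∀ u : EMon V m, ((p - k • q) u.idx).coeff u.mon =
      (p u.idx).coeff u.mon - k * (q u.idx).coeff u.mon := fun u => by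
    rw [Pi.sub_apply, Pi.smul_apply, coeff_sub, coeff_smul]
  refine ⟨?_, fun u hu => ?_⟩
  · have h0 : (q s.idx).coeff s.mon = 0 := by
      by_contra h0
      exact absurd (hq.2 s h0) (not_le.2 h)
    rw [hc, h0, mul_zero, sub_zero]
    exact hp.1
  · rw [hc] at hu
    by_cases h0 : (p u.idx).coeff u.mon = 0
    · refine (hq.2 u fun h1 => hu ?_).trans h.le
      rw [h0, h1, mul_zero, sub_zero]
    · exact hp.2 u h0

/-- Two elements of `E` with the same leading monomial can be combined to an element all of whose
monomials are smaller. -/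
theorem IsLeadE.exists_cancel {p q : Fin m → PathAlgebra K V} {s : EMon V m} (hp : IsLeadE p s)
    (hq : IsLeadE q s) :
    ∃ k : K, k ≠ 0 ∧ ∀ u : EMon V m, ((p - k • q) u.idx).coeff u.mon ≠ 0 → u < s := by
  refine ⟨(p s.idx).coeff s.mon / (q s.idx).coeff s.mon, div_ne_zero hp.1 hq.1, fun u hu => ?_⟩
  rw [Pi.sub_apply, Pi.smul_apply, coeff_sub, coeff_smul] at hu
  refine lt_of_le_of_ne ?_ ?_
  · by_cases h0 : (p u.idx).coeff u.mon = 0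
    · refine hq.2 u fun h1 => hu ?_
      rw [h0, h1, mul_zero, sub_zero]
    · exact hp.2 u h0
  · rintro rfl
    rw [div_mul_cancel₀ _ hq.1, sub_self] at hu
    exact hu rfl

variable (ψ ghat) in
/-- `f ∈ M`, possibly zero, has the signature `s`, in a strengthened sense: `f` is supported on
monomials that end at the same vertex as `s`. All elements that occur in a run of the algorithm are
of this kind. -/
structure HasSignature (f : Fin r → A) (s : EMon V m) : Prop where
  uniform : op (ψ (of K (PathMon.triv s.mon.tgt))) • f = f
  exists_lift : ∃ p : Fin m → PathAlgebra K V, IsLeadE p s ∧ ev ψ ghat p = f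

theorem HasSignature.isKerLM {s : EMon V m} (h : HasSignature ψ ghat (0 : Fin r → A) s) :
    IsKerLM ψ ghat s := by
  obtain ⟨p, hp, h0⟩ := h.exists_lift
  exact ⟨p, h0, hp⟩

theorem op_smul_sub_smul (a : A) (k : K) (f g : Fin r → A) :
    op a • (f - k • g) = op a • f - k • (op a • g) := by
  ext j
  simp [sub_mul]

theorem HasSignature.sub_smul {f g : Fin r → A} {s s' : EMon V m} (hf : HasSignature ψ ghat f s)
    (hg : HasSignature ψ ghat g s') (h : s' < s) (htgt : s'.mon.tgt = s.mon.tgt) (k : K) :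
    HasSignature ψ ghat (f - k • g) s := by
  obtain ⟨p, hp, hpf⟩ := hf.exists_lift
  obtain ⟨q, hq, hqg⟩ := hg.exists_lift
  refine ⟨?_, _, hp.sub_smul hq h k, by rw [ev_sub_smul, hpf, hqg]⟩
  rw [op_smul_sub_smul, hf.uniform, ← htgt, hg.uniform]

theorem HasSignature.mem_signedElements {f : Fin r → A} {s : EMon V m}
    (h : HasSignature ψ ghat f s) (hf : f ≠ 0) :
    (⟨f, s⟩ : SPair A V r m) ∈
      signedElements ψ (Submodule.span Aᵐᵒᵖ (Set.range ghat)) ghat := by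
  obtain ⟨p, hp, hpf⟩ := h.exists_lift
  refine ⟨?_, hf, p, hp, hpf⟩
  change f ∈ _
  rw [← hpf]
  exact ev_mem_span p

theorem hasSignature_initial (i : Fin m) (v : V) :
    HasSignature ψ ghat (op (ψ (of K (PathMon.triv v))) • ghat i) ⟨i, PathMon.triv v⟩ := by
  classical
  refine ⟨?_, Pi.single i (of K (PathMon.triv v)), ⟨?_, ?_⟩, ev_single i _⟩
  · change op (ψ (of K (PathMon.triv v))) • _ = _
    rw [smul_smul, ← op_mul, ← map_mul, of_mul_of, PathMon.mul_triv (PathMon.triv v) v rfl]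
    rfl
  · dsimp only
    rw [Pi.single_eq_same, coeff_of_self]
    exact one_ne_zero
  · rintro ⟨j, b⟩ hu
    dsimp only at hu
    by_cases hj : j = i
    · subst hj
      rw [Pi.single_eq_same] at hu
      by_cases hbv : b = PathMon.triv v
      · rw [hbv]
      · exact absurd (coeff_of_ne hbv) hu
    · rw [Pi.single_eq_of_ne hj] at hu
      exact absurd rfl hu

variable {G : Set (SPair A V r m)} {L : Set (EMon V m)}

variable (ψ ghat) in
/-- A finite set of signed elements with the properties that are maintained by the algorithm. -/
structure IsGoodSet (G : Set (SPair A V r m)) : Prop where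
  finite : G.Finite
  ne_zero : ∀ g ∈ G, g.poly ≠ 0
  hasSignature : ∀ g ∈ G, HasSignature ψ ghat g.poly g.sig

variable (ψ ghat) in
/-- The properties of `G` and `L` that are maintained by the algorithm. -/
structure Invariant (G : Set (SPair A V r m)) (L : Set (EMon V m)) : Prop where
  good : IsGoodSet ψ ghat G
  isKerLM : ∀ s ∈ L, IsKerLM ψ ghat s
  exists_sig : ∀ (i : Fin m) (v : V), ¬ IsKerLM ψ ghat ⟨i, PathMon.triv v⟩ →
    ∃ g ∈ G, g.sig = ⟨i, PathMon.triv v⟩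

theorem IsGoodSet.mono {G' : Set (SPair A V r m)} (h : IsGoodSet ψ ghat G) (hG : G' ⊆ G) :
    IsGoodSet ψ ghat G' :=
  ⟨h.finite.subset hG, fun g hg => h.ne_zero g (hG hg), fun g hg => h.hasSignature g (hG hg)⟩

theorem IsGoodSet.insert (h : IsGoodSet ψ ghat G) {f : Fin r → A} {s : EMon V m} (hf : f ≠ 0)
    (hs : HasSignature ψ ghat f s) : IsGoodSet ψ ghat (insert ⟨f, s⟩ G) := by
  refine ⟨h.finite.insert _, ?_, ?_⟩
  · rintro g (rfl | hg)
    · exact hf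
    · exact h.ne_zero g hg
  · rintro g (rfl | hg)
    · exact hs
    · exact h.hasSignature g hg

/-- The invariant persists if a set is replaced by another one, provided that each trivial signature
that gets lost is a leading monomial of the kernel. -/
theorem Invariant.of_sig (h : Invariant ψ ghat G L) {G' : Set (SPair A V r m)}
    {L' : Set (EMon V m)} (hG' : IsGoodSet ψ ghat G') (hL' : ∀ s ∈ L', IsKerLM ψ ghat s)
    (hs : ∀ g ∈ G, g.sig.mon.length = 0 → IsKerLM ψ ghat g.sig ∨ ∃ g' ∈ G', g'.sig = g.sig) :
    Invariant ψ ghat G' L' := by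
  refine ⟨hG', hL', fun i v hk => ?_⟩
  obtain ⟨g, hg, hgs⟩ := h.exists_sig i v hk
  rcases hs g hg (by rw [hgs]; rfl) with h1 | ⟨g', hg', h2⟩
  · exact absurd (hgs ▸ h1) hk
  · exact ⟨g', hg', h2.trans hgs⟩

variable [LinearOrder (PathMon V)]

theorem IsLeadE.mul (hE : IsCompatibleE V m) {p : Fin m → PathAlgebra K V} {s t : EMon V m}
    {c : PathMon V} (h : IsLeadE p s) (hst : s.MulEq c t) :
    IsLeadE (fun i => p i * of K c) t := by
  refine ⟨?_, fun u hu => ?_⟩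
  · change (p t.idx * of K c).coeff t.mon ≠ 0
    rw [coeff_mul_of hst.2, hst.1]
    exact h.1
  · obtain ⟨a, ha, ha'⟩ := exists_of_coeff_mul_of_ne_zero hu
    have hau : EMon.MulEq ⟨u.idx, a⟩ c u := ⟨rfl, ha⟩
    rcases (h.2 ⟨u.idx, a⟩ ha').eq_or_lt with he | hlt
    · rw [he] at hau
      exact (hau.unique hst).le
    · exact (hE.mul _ _ _ _ _ hlt hst hau).le

theorem IsKerLM.mul (hE : IsCompatibleE V m) {s t : EMon V m} {c : PathMon V}
    (h : IsKerLM ψ ghat s) (hst : s.MulEq c t) : IsKerLM ψ ghat t := by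
  obtain ⟨p, hp, hps⟩ := h
  exact ⟨_, by rw [ev_mul, hp, smul_zero], hps.mul hE hst⟩

theorem HasSignature.mul (hE : IsCompatibleE V m) {f : Fin r → A} {s t : EMon V m}
    {c : PathMon V} (h : HasSignature ψ ghat f s) (hst : s.MulEq c t) :
    HasSignature ψ ghat (op (ψ (of K c)) • f) t := by
  obtain ⟨p, hp, hpf⟩ := h.exists_lift
  refine ⟨?_, _, hp.mul hE hst, by rw [ev_mul, hpf]⟩
  rw [smul_smul, ← op_mul, ← map_mul, of_mul_of, PathMon.tgt_of_mul hst.2, PathMon.mul_tgt]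
  rfl

theorem HasSignature.tgt_eq [LinearOrder (FMon ψ r)] (hb : HasPreferredBasis ψ)
    {f : Fin r → A} {s : EMon V m} (h : HasSignature ψ ghat f s) {t : FMon ψ r}
    (ht : IsLM ψ f t) : t.mon.1.tgt = s.mon.tgt := by
  by_contra hne
  have := (coefF_triv hb f _ t).2 hne
  rw [h.uniform] at this
  exact ((isLM_iff hb).1 ht).1 this

/-- Replacing the coefficients of a lift by their normal forms, and multiplying by the vertex at
which the leading monomial of the element ends, yields a standard signature that is not greater than
the given one, without any change of the leading monomial. -/
theorem exists_hasSignature [LinearOrder (FMon ψ r)]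
    (hb : HasPreferredBasis ψ) (hE : IsCompatibleE V m) {p : Fin m → PathAlgebra K V}
    {t : FMon ψ r} (ht : IsLM ψ (ev ψ ghat p) t) :
    ∃ (f : Fin r → A) (s u : EMon V m), IsStd ψ s.mon ∧ HasSignature ψ ghat f s ∧ IsLM ψ f t ∧
      (p u.idx).coeff u.mon ≠ 0 ∧ s ≤ u := by
  set w := t.mon.1.tgt with hw
  set q : Fin m → PathAlgebra K V :=
    fun i => stdLift ψ ((stdBasis hb).repr (ψ (p i))) * of K (PathMon.triv w) with hq
  have hev : ev ψ ghat q = op (ψ (of K (PathMon.triv w))) • ev ψ ghat p := by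
    rw [hq, ev_mul]
    exact congrArg _ (ev_congr fun i => map_stdLift_repr hb _)
  have hlm : IsLM ψ (ev ψ ghat q) t := by
    rw [isLM_iff hb] at ht ⊢
    rw [hev]
    refine ⟨by rw [(coefF_triv hb _ w t).1 rfl]; exact ht.1, fun u hu => ?_⟩
    by_cases hu' : u.mon.1.tgt = w
    · rw [(coefF_triv hb _ w u).1 hu'] at hu
      exact ht.2 u hu
    · exact absurd ((coefF_triv hb _ w u).2 hu') hu
  have hq0 : q ≠ 0 := by
    intro h0
    refine hlm.ne_zero hb ?_
    rw [h0]
    simp [ev]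
  obtain ⟨s, hs⟩ := exists_isLeadE hq0
  obtain ⟨a, ha, ha'⟩ := exists_of_coeff_mul_of_ne_zero hs.1
  have hsw : s.mon.tgt = w := by
    have h := PathMon.tgt_of_mul ha
    exact h
  have has : a = s.mon := by
    rw [PathMon.mul_triv a w (PathMon.tgt_eq_src_of_mul ha)] at ha
    exact Option.some.inj ha
  subst has
  obtain ⟨b, hpb, hle⟩ := exists_le_of_coeff_stdLift hb ha'
  refine ⟨ev ψ ghat q, s, ⟨s.idx, b⟩, isStd_of_coeff_stdLift ha', ⟨?_, q, hs, rfl⟩, hlm, hpb, ?_⟩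
  · rw [hsw, hev, smul_smul, ← op_mul, ← map_mul, of_mul_of,
      PathMon.mul_triv (PathMon.triv w) w rfl]
    rfl
  · rcases hle.eq_or_lt with he | hlt
    · rw [← he]
    · exact (hE.of_lt s.idx b s.mon hlt).le

end Signature

/-! ### Multiples of signed elements -/

section Multiples

variable {K V A : Type*} [Field K] [Quiver V] [Fintype V] [LinearOrder (PathMon V)]
  [Ring A] [Algebra K A] {ψ : PathAlgebra K V →ₐ[K] A} {r m : ℕ} {ghat : Fin m → Fin r → A}
  [LinearOrder (FMon ψ r)]

/-- The trivial path at the end of a standard monomial. -/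
def StdMon.end (hP : IsMonomialOrdering V) (b : StdMon ψ) : StdMon ψ :=
  ⟨PathMon.triv b.1.tgt, b.2.right hP (PathMon.mul_tgt b.1)⟩

theorem HasMultiple.self (hP : IsMonomialOrdering V) {g : SPair A V r m} {t : FMon ψ r}
    (ht : IsLM ψ g.poly t) (htgt : t.mon.1.tgt = g.sig.mon.tgt) :
    HasMultiple ψ g (StdMon.end hP t.mon) t g.sig :=
  ⟨⟨t, ht, rfl, PathMon.mul_tgt _⟩, g.sig.mulEq_triv htgt.symm⟩

theorem HasMultiple.isLM (hb : HasPreferredBasis ψ) (hF : IsCompatibleF ψ r) {g : SPair A V r m}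
    {c : StdMon ψ} {t : FMon ψ r} {s : EMon V m} (h : HasMultiple ψ g c t s) :
    IsLM ψ (op (StdMon.val ψ c) • g.poly) t := by
  obtain ⟨⟨u, hu, hut⟩, -⟩ := h
  exact hu.mul hb hF hut

end Multiples

/-! ### Exit from the loop yields a signed standard basis -/

section Correctness

variable {K V A : Type*} [Field K] [Quiver V] [Fintype V] [LinearOrder (PathMon V)]
  [Ring A] [Algebra K A] {ψ : PathAlgebra K V →ₐ[K] A} {r m : ℕ} {ghat : Fin m → Fin r → A}
  [LinearOrder (FMon ψ r)] [LinearOrder (EMon V m)]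
  {G : Set (SPair A V r m)} {L : Set (EMon V m)}

/-- When the loop is left, the signature of each S-polynomial of type T is rewritable, provided that
it is standard and not a leading monomial of the kernel: then it is standard relative to `L`, and
the members of the pair are irreducible as `G` is interreduced, so that the pair is normal. -/
theorem isRewritable_of_typeT (hE : IsCompatibleE V m)
    (hexit : ∀ p s, ¬ LoopCondition ψ G L p s) (hred : IsInterreduced ψ G)
    (hL : ∀ s ∈ L, IsKerLM ψ ghat s) {g : SPair A V r m} (hg : g ∈ G) {u : FMon ψ r}
    (hu : IsLM ψ g.poly u) {c : StdMon ψ} (hc : IsMinTopplingCofactor ψ u.mon c) {s : EMon V m}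
    (hs : g.sig.MulEq c.1 s) (hstd : IsStd ψ s.mon) (hker : ¬ IsKerLM ψ ghat s) :
    IsRewritable ψ G s := by
  by_contra hnr
  refine hexit (.typeT g c) s ⟨⟨⟨hg, u, hu, hc⟩, hs, ⟨hstd, ?_⟩, hred.1 g hg⟩, hnr⟩
  rintro ⟨l, hl, d, hd⟩
  exact hker ((hL l hl).mul hE hd)

/-- When the loop is left, the signature of each S-polynomial of type S is rewritable, provided that
it is standard and not a leading monomial of the kernel: then it is standard relative to `L`, and
the members of the pair are irreducible as `G` is interreduced, so that the pair is normal. -/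
theorem isRewritable_of_typeS (hE : IsCompatibleE V m)
    (hexit : ∀ p s, ¬ LoopCondition ψ G L p s) (hred : IsInterreduced ψ G)
    (hL : ∀ s ∈ L, IsKerLM ψ ghat s) {g g' : SPair A V r m} (hg : g ∈ G) (hg' : g' ∈ G)
    {t : FMon ψ r} (ht : IsLM ψ g'.poly t) {c : StdMon ψ} {s : EMon V m}
    (hm : HasMultiple ψ g c t s) (hlt : g'.sig < s) (hstd : IsStd ψ s.mon)
    (hker : ¬ IsKerLM ψ ghat s) : IsRewritable ψ G s := by
  by_contra hnr
  refine hexit (.typeS g g' c) s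
    ⟨⟨⟨hg, hg', t, s, ht, hm, hlt⟩, hm.2, ⟨hstd, ?_⟩, hred.1 g hg, hred.1 g' hg'⟩, hnr⟩
  rintro ⟨l, hl, d, hd⟩
  exact hker ((hL l hl).mul hE hd)

/-- If a proper initial piece `s'` of `s` is rewritable, then so is a longer one. The multiple
`poly(g) · c` that rewrites `s'` is multiplied further: if this fails to be possible without a
toppling, then there is a critical pair of type T, and if the result is reducible, then there is one
of type S; the signatures of both lie strictly between `s'` and `s`. -/
theorem exists_longer_isRewritable (hP : IsMonomialOrdering V) (hb : HasPreferredBasis ψ)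
    (hF : IsCompatibleF ψ r) (hE : IsCompatibleE V m)
    (hexit : ∀ p s, ¬ LoopCondition ψ G L p s) (hred : IsInterreduced ψ G)
    (hL : ∀ s ∈ L, IsKerLM ψ ghat s) {s s' : EMon V m} {d : PathMon V} (hstd : IsStd ψ s.mon)
    (hker : ¬ IsKerLM ψ ghat s) (hs' : IsRewritable ψ G s') (hd : s'.MulEq d s) :
    IsRewritable ψ G s ∨
      ∃ s'' d', IsRewritable ψ G s'' ∧ s''.MulEq d' s ∧ d'.length < d.length := by
  obtain ⟨g, hg, c, t, ⟨⟨u, hu, hut⟩, hgs⟩, hirr⟩ := hs'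
  have hlmt := hu.mul hb hF hut
  obtain ⟨cd, hcd⟩ : ∃ cd, c.1.mul d = some cd :=
    PathMon.exists_mul ((PathMon.tgt_of_mul hgs.2).symm.trans (PathMon.tgt_eq_src_of_mul hd.2))
  have hgcd : g.sig.MulEq cd s := hgs.trans hd hcd
  have hcdstd : IsStd ψ cd := hstd.right hP hgcd.2
  -- initial pieces of `s` inherit the hypotheses on `s`
  have hpre : ∀ {x : EMon V m} {y : PathMon V}, x.MulEq y s →
      IsStd ψ x.mon ∧ ¬ IsKerLM ψ ghat x :=
    fun hxy => ⟨hstd.left hP hxy.2, fun hx => hker (hx.mul hE hxy)⟩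
  by_cases hsmall : IsSmallCofactor ψ u.mon ⟨cd, hcdstd⟩
  · obtain ⟨x, hx⟩ := hsmall
    have hux : u.MulEq ⟨cd, hcdstd⟩ ⟨u.idx, x⟩ := ⟨rfl, hx⟩
    by_cases hirr' : IsIrreducible ψ (op (StdMon.val ψ ⟨cd, hcdstd⟩) • g.poly) s G
    · exact Or.inl ⟨g, hg, _, _, ⟨⟨u, hu, hux⟩, hgcd⟩, hirr'⟩
    right
    obtain ⟨t', ht', g', hg', c', s₁, ⟨⟨u', hu', hut'⟩, hgs'⟩, hlt⟩ :=
      not_not.1 (not_or.1 hirr').2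
    obtain rfl := ht'.unique hb (hu.mul hb hF hux)
    -- the reductor cannot act within `poly(g) · c`, which is irreducible; cancel `d` on both sides
    have hcontra : ∀ f, u'.mon.1.mul f = some t.mon.1 → f.mul d = some c'.1 → False := by
      intro f hf hfd
      obtain ⟨s₂, hs₂, hs₂'⟩ := hgs'.split hfd
      rcases hirr with h0 | hirr
      · exact hlmt.ne_zero hb h0
      · exact hirr ⟨t, hlmt, g', hg', ⟨f, t.mon.2.right hP hf⟩, s₂,
          ⟨⟨u', hu', hut.1.trans hut'.1, hf⟩, hs₂⟩, EMon.lt_of_mulEq hE hd hs₂' hlt⟩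
    rcases PathMon.comparable hx hut'.2 with ⟨e, he, he'⟩ | ⟨e, he, he'⟩
    · rcases PathMon.comparable hcd he' with ⟨f, hf, hf'⟩ | ⟨f, hf, hf'⟩
      · have hflen : f.length ≠ 0 := by
          intro h0
          obtain rfl := PathMon.eq_of_mul_of_length hf h0
          have hd' : c'.1 = d := PathMon.eq_of_mul_of_length' hf' h0
          have hut1 : u'.mon.1 = t.mon.1 := Option.some.inj (he.symm.trans hut.2)
          refine hcontra (PathMon.triv t.mon.1.tgt) (by rw [hut1, PathMon.mul_tgt]) ?_
          rw [hd', PathMon.triv_mul _ _ ?_]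
          rw [PathMon.tgt_of_mul hut.2]
          exact PathMon.tgt_eq_src_of_mul hcd
        obtain ⟨s₂, hs₂, hs₂'⟩ := hgcd.split he'
        refine ⟨s₂, c'.1, ?_, hs₂', ?_⟩
        · refine isRewritable_of_typeS hE hexit hred hL hg hg' hu'
            (c := ⟨e, hcdstd.left hP he'⟩) ⟨⟨u, hu, ?_, he⟩, hs₂⟩ ?_ (hpre hs₂').1 (hpre hs₂').2
          · exact hut'.1.symm
          · exact EMon.lt_of_mulEq hE hs₂' hgs' hlt
        · have := PathMon.length_of_mul hf'
          omega
      · obtain ⟨y, hy, hy'⟩ := PathMon.mul_assoc_left hf hut.2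
        rw [he] at hy
        obtain rfl := Option.some.inj hy
        exact (hcontra f hy' hf').elim
    · obtain ⟨ec, hec, hec'⟩ := PathMon.mul_assoc_left hcd he'
      exact (hcontra ec (PathMon.mul_comm_assoc he hec hut.2) hec').elim
  · right
    obtain ⟨c₁, ⟨d₁, hd₁⟩, hc₁⟩ := exists_isMinTopplingCofactor hsmall
    have hcsmall : IsSmallCofactor ψ u.mon c := ⟨t.mon, hut.2⟩
    obtain ⟨s₂, hs₂, hs₂'⟩ := hgcd.split hd₁
    refine ⟨s₂, d₁, isRewritable_of_typeT hE hexit hred hL hg hu hc₁ hs₂ (hpre hs₂').1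
      (hpre hs₂').2, hs₂', ?_⟩
    rcases PathMon.comparable hcd hd₁ with ⟨e, he, he'⟩ | ⟨e, he, he'⟩
    · have helen : e.length ≠ 0 := by
        intro h0
        rw [Subtype.ext (PathMon.eq_of_mul_of_length he h0)] at hcsmall
        exact hc₁.1 hcsmall
      have := PathMon.length_of_mul he'
      omega
    · exact (hc₁.1 (hcsmall.left hP ⟨e, he⟩)).elim

/-- When the loop is left, each standard signature that is not a leading monomial of the kernel is
rewritable. -/
theorem isRewritable_of_exit (hP : IsMonomialOrdering V) (hb : HasPreferredBasis ψ)
    (hF : IsCompatibleF ψ r) (hE : IsCompatibleE V m) (hG : IsGoodSet ψ ghat G)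
    (hexit : ∀ p s, ¬ LoopCondition ψ G L p s) (hred : IsInterreduced ψ G)
    (hL : ∀ s ∈ L, IsKerLM ψ ghat s)
    (hgen : ∀ (i : Fin m) (v : V), ¬ IsKerLM ψ ghat ⟨i, PathMon.triv v⟩ →
      ∃ g ∈ G, g.sig = ⟨i, PathMon.triv v⟩)
    {s : EMon V m} (hstd : IsStd ψ s.mon) (hker : ¬ IsKerLM ψ ghat s) : IsRewritable ψ G s := by
  have key : ∀ (n : ℕ) (s' : EMon V m) (d : PathMon V), d.length = n → IsRewritable ψ G s' →
      s'.MulEq d s → IsRewritable ψ G s := by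
    intro n
    induction n using Nat.strong_induction_on with
    | _ n ih =>
      intro s' d hn hs' hd
      rcases exists_longer_isRewritable hP hb hF hE hexit hred hL hstd hker hs' hd with
        h | ⟨s'', d', hs'', hd', hlt⟩
      · exact h
      · exact ih _ (hn ▸ hlt) s'' d' rfl hs'' hd'
  have h1 : EMon.MulEq ⟨s.idx, PathMon.triv s.mon.src⟩ s.mon s := ⟨rfl, PathMon.src_mul s.mon⟩
  obtain ⟨g, hg, hgs⟩ := hgen s.idx s.mon.src fun h => hker (h.mul hE h1)
  refine key _ g.sig s.mon rfl ?_ (hgs ▸ h1)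
  obtain ⟨t, ht⟩ := exists_isLM hb (hG.ne_zero g hg)
  have htgt := (hG.hasSignature g hg).tgt_eq hb ht
  refine ⟨g, hg, _, t, HasMultiple.self hP ht htgt, ?_⟩
  have : op (StdMon.val ψ (StdMon.end hP t.mon)) • g.poly = g.poly := by
    have := (hG.hasSignature g hg).uniform
    rw [← htgt] at this
    exact this
  rw [this]
  exact hred.1 g hg

/-- When the loop is left, each element of `M ∖ {0}` with a signature `s` is weakly `s`-reducible;
the proof is by induction on `s`. If the leading monomial of `f` also belongs to an element of
smaller signature, then the induction hypothesis applies. Otherwise `s` is not a leading monomial of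
the kernel, hence it is rewritable; the rewriting multiple must have the same leading monomial as
`f`, since otherwise cancellation of the leading terms of the lifts would yield an element of
smaller signature which either has the leading monomial of `f` or makes the multiple reducible. -/
theorem isWeaklyReducible_of_exit (hb : HasPreferredBasis ψ)
    (hadm : IsAdmissible ψ)
    (hF : IsCompatibleF ψ r) (hE : IsCompatibleE V m) (hG : IsGoodSet ψ ghat G)
    (hrew : ∀ s : EMon V m, IsStd ψ s.mon → ¬ IsKerLM ψ ghat s → IsRewritable ψ G s)
    {f : Fin r → A} {s : EMon V m} {t : FMon ψ r} (hstd : IsStd ψ s.mon)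
    (hf : HasSignature ψ ghat f s)
    (ht : IsLM ψ f t) : IsWeaklyReducible ψ f s G := by
  have key : ∀ s ∈ {s : EMon V m | IsStd ψ s.mon}, ∀ (f : Fin r → A) (t : FMon ψ r),
      HasSignature ψ ghat f s → IsLM ψ f t →
      ∃ g ∈ G, ∃ c s', HasMultiple ψ g c t s' ∧ s' ≤ s := by
    intro s hs
    refine (isWF_isStd hadm hE).induction
      (P := fun s => ∀ (f : Fin r → A) (t : FMon ψ r), HasSignature ψ ghat f s →
        IsLM ψ f t → ∃ g ∈ G, ∃ c s', HasMultiple ψ g c t s' ∧ s' ≤ s)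
      hs (fun s hs ih f t hf ht => ?_)
    by_cases hsmaller : ∃ f' s', s' < s ∧ IsStd ψ s'.mon ∧ HasSignature ψ ghat f' s' ∧ IsLM ψ f' t
    · obtain ⟨f', s', hlt, hstd', hf', ht'⟩ := hsmaller
      obtain ⟨g, hg, c, s'', hm, hle⟩ := ih s' hstd' hlt f' t hf' ht'
      exact ⟨g, hg, c, s'', hm, hle.trans hlt.le⟩
    obtain ⟨p, hp, hpf⟩ := hf.exists_lift
    have hker : ¬ IsKerLM ψ ghat s := by
      rintro ⟨q, hq, hqs⟩
      obtain ⟨k, -, hk⟩ := hp.exists_cancel hqs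
      have hev : ev ψ ghat (p - k • q) = f := by rw [ev_sub_smul, hq, smul_zero, sub_zero, hpf]
      obtain ⟨f', s', u, hstd', hf', ht', hu, hle⟩ := exists_hasSignature hb hE (hev ▸ ht)
      exact hsmaller ⟨f', s', hle.trans_lt (hk u hu), hstd', hf', ht'⟩
    obtain ⟨g, hg, c, t₀, hm, hirr⟩ := hrew s hs hker
    have ht₀ := hm.isLM hb hF
    obtain ⟨q, hq, hqg⟩ := ((hG.hasSignature g hg).mul hE hm.2).exists_lift
    obtain ⟨k, hk0, hk⟩ := hp.exists_cancel hq
    have hev : ev ψ ghat (p - k • q) = f - k • (op (StdMon.val ψ c) • g.poly) := by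
      rw [ev_sub_smul, hpf, hqg]
      rfl
    by_cases htt : t = t₀
    · exact ⟨g, hg, c, s, htt ▸ hm, le_rfl⟩
    exfalso
    have hlm := ht.sub_smul hb hk0 ht₀ htt
    rw [← hev] at hlm
    obtain ⟨f', s', u, hstd', hf', ht', hu, hle⟩ := exists_hasSignature hb hE hlm
    have hs's : s' < s := hle.trans_lt (hk u hu)
    rcases le_total t t₀ with h | h
    · rw [max_eq_right h] at ht'
      obtain ⟨g', hg', c', s'', hm', hle'⟩ := ih s' hstd' hs's f' t₀ hf' ht'
      rcases hirr with h0 | hirr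
      · exact ht₀.ne_zero hb h0
      · exact hirr ⟨t₀, ht₀, g', hg', c', s'', hm', hle'.trans_lt hs's⟩
    · rw [max_eq_left h] at ht'
      exact hsmaller ⟨f', s', hs's, hstd', hf', ht'⟩
  exact ⟨t, ht, key s hstd f t hf ht⟩

theorem isSignedStandardBasis_of_exit (hP : IsMonomialOrdering V) (hb : HasPreferredBasis ψ)
    (hadm : IsAdmissible ψ) (hF : IsCompatibleF ψ r) (hE : IsCompatibleE V m)
    (hG : IsGoodSet ψ ghat G)
    (hexit : ∀ p s, ¬ LoopCondition ψ G L p s) (hred : IsInterreduced ψ G)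
    (hL : ∀ s ∈ L, IsKerLM ψ ghat s)
    (hgen : ∀ (i : Fin m) (v : V), ¬ IsKerLM ψ ghat ⟨i, PathMon.triv v⟩ →
      ∃ g ∈ G, g.sig = ⟨i, PathMon.triv v⟩) :
    IsSignedStandardBasis ψ (Submodule.span Aᵐᵒᵖ (Set.range ghat)) ghat G := by
  refine ⟨hG.finite, fun g hg => (hG.hasSignature g hg).mem_signedElements (hG.ne_zero g hg), ?_⟩
  rintro ⟨f, σ⟩ ⟨-, hf0, p, hp, hpf⟩ -
  dsimp only at hf0 hp hpf ⊢
  obtain ⟨t, ht⟩ := exists_isLM hb hf0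
  obtain ⟨f', s, u, hstd', hf', ht', hu, hle⟩ := exists_hasSignature hb hE (hpf.symm ▸ ht)
  obtain ⟨t', ht'', g, hg, c, s', hm, hs'⟩ := isWeaklyReducible_of_exit hb hadm hF hE hG
    (fun s hstd hker => isRewritable_of_exit hP hb hF hE hG hexit hred hL hgen hstd hker)
    hstd' hf' ht'
  obtain rfl := ht'.unique hb ht''
  exact ⟨t, ht, g, hg, c, s', hm, hs'.trans (hle.trans (hp.2 u hu))⟩

end Correctness

/-! ### Invariants of the algorithm -/

section Invariants

variable {K V A : Type*} [Field K] [Quiver V] [Fintype V] [LinearOrder (PathMon V)]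
  [Ring A] [Algebra K A] {ψ : PathAlgebra K V →ₐ[K] A} {r m : ℕ} {ghat : Fin m → Fin r → A}
  [LinearOrder (FMon ψ r)] [LinearOrder (EMon V m)]
  {G : Set (SPair A V r m)} {L : Set (EMon V m)}

variable (ψ ghat) in
/-- The properties of the states of the interreduction procedure that are maintained. If `g` is
being reduced, then the remainder `f` still has the signature of `g`, and its leading monomial is
smaller than that of `g` as soon as some reduction has taken place. -/
structure InterInvariant (hb : HasPreferredBasis ψ) (S : InterState A V r m) : Prop where
  inv : Invariant ψ ghat S.G S.L
  work : ∀ g f, S.work = some (g, f) → g ∈ S.G ∧ IsReducible ψ g.poly g.sig (S.G \ {g}) ∧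
    HasSignature ψ ghat f g.sig ∧ (f = g.poly ∨ lmBot hb f < lmBot hb g.poly)

variable (ψ ghat) in
/-- The properties of the states of the algorithm that are maintained. -/
def StateInvariant (hb : HasPreferredBasis ψ) : State A V r m → Prop
  | .start S => InterInvariant ψ ghat hb S
  | .loopHead G L => Invariant ψ ghat G L ∧ IsInterreduced ψ G
  | .normalForm G L s f => Invariant ψ ghat G L ∧ IsInterreduced ψ G ∧ HasSignature ψ ghat f s
  | .update S => InterInvariant ψ ghat hb S
  | .returned G => IsInterreduced ψ G ∧
      IsSignedStandardBasis ψ (Submodule.span Aᵐᵒᵖ (Set.range ghat)) ghat G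

/-- A top reduction preserves the signature and diminishes the leading monomial. -/
theorem TopReduction.hasSignature (hb : HasPreferredBasis ψ) (hF : IsCompatibleF ψ r)
    (hE : IsCompatibleE V m) (hG : IsGoodSet ψ ghat G) {s : EMon V m} {f f' : Fin r → A}
    (hf : HasSignature ψ ghat f s) (h : TopReduction ψ G s f f') :
    HasSignature ψ ghat f' s ∧ lmBot hb f' < lmBot hb f := by
  obtain ⟨t, a, hfa, g, hg, c, s', ⟨⟨u', hu', hut⟩, hs'⟩, hlt, u, a', hga, rfl⟩ := h
  obtain rfl := hu'.unique hb ⟨a', hga⟩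
  have h1 := (hG.hasSignature g hg).mul hE hs'
  have h2 := hga.mul hb hF hut
  refine ⟨hf.sub_smul h1 hlt ?_ _, lmBot_sub_lt hb hfa h2⟩
  rw [← hf.tgt_eq hb ⟨a, hfa⟩]
  exact (h1.tgt_eq hb ⟨a', h2⟩).symm

theorem IsReducible.exists_topReduction {f : Fin r → A} {s : EMon V m}
    (h : IsReducible ψ f s G) : ∃ f', TopReduction ψ G s f f' := by
  obtain ⟨t, ⟨a, ha⟩, g, hg, c, s', hm, hlt⟩ := h
  obtain ⟨⟨u, ⟨a', ha'⟩, hut⟩, hs'⟩ := hm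
  exact ⟨_, t, a, ha, g, hg, c, s', ⟨⟨u, ⟨a', ha'⟩, hut⟩, hs'⟩, hlt, u, a', ha', rfl⟩

/-- An element never reduces itself. -/
theorem IsReducible.diff_singleton (hb : HasPreferredBasis ψ) {g : SPair A V r m}
    (h : IsReducible ψ g.poly g.sig G) : IsReducible ψ g.poly g.sig (G \ {g}) := by
  obtain ⟨t, ht, g', hg', c, s', hm, hlt⟩ := h
  refine ⟨t, ht, g', ⟨hg', ?_⟩, c, s', hm, hlt⟩
  rintro rfl
  obtain ⟨⟨u, hu, hut⟩, hs'⟩ := hm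
  obtain rfl := hu.unique hb ht
  have h1 := PathMon.length_of_mul hut.2
  have h2 := PathMon.eq_of_mul_of_length hs'.2 (by omega)
  rw [ModMon.ext hs'.1 h2.symm] at hlt
  exact lt_irrefl _ hlt

theorem InterInvariant.step (hb : HasPreferredBasis ψ) (hF : IsCompatibleF ψ r)
    (hE : IsCompatibleE V m) {S S' : InterState A V r m} (h : InterInvariant ψ ghat hb S)
    (hS : InterStep ψ S S') : InterInvariant ψ ghat hb S' := by
  cases hS with
  | drop G L g g' hg hg' hne hcov =>
    refine ⟨h.inv.of_sig (h.inv.good.mono Set.sdiff_subset) h.inv.isKerLM fun x hx hlen => ?_,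
      fun _ _ hw => by cases hw⟩
    by_cases hxg : x = g
    · subst hxg
      -- a trivial signature is a multiple of itself only
      obtain ⟨t, c, -, -, hmul⟩ := hcov
      have h1 := PathMon.length_of_mul hmul.2
      have h2 := PathMon.eq_of_mul_of_length hmul.2 (by omega)
      exact Or.inr ⟨g', ⟨hg', hne⟩, ModMon.ext hmul.1.symm h2⟩
    · exact Or.inr ⟨x, ⟨hx, hxg⟩, rfl⟩
  | choose G L g hg hr =>
    refine ⟨h.inv, fun g₁ f₁ hw => ?_⟩
    cases hw
    exact ⟨hg, hr, h.inv.good.hasSignature g hg, Or.inl rfl⟩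
  | reduce G L g f f' hf =>
    refine ⟨h.inv, fun g₁ f₁ hw => ?_⟩
    cases hw
    obtain ⟨hg, hr, hs, hlm⟩ := h.work g f rfl
    obtain ⟨h1, h2⟩ := hf.hasSignature hb hF hE (h.inv.good.mono Set.sdiff_subset) hs
    refine ⟨hg, hr, h1, Or.inr ?_⟩
    rcases hlm with rfl | hlm
    · exact h2
    · exact h2.trans hlm
  | replace G L g f hf hirr =>
    obtain ⟨hg, hr, hs, hlm⟩ := h.work g f rfl
    refine ⟨h.inv.of_sig ((h.inv.good.mono Set.sdiff_subset).insert hf hs) h.inv.isKerLM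
      fun x hx _ => Or.inr ?_, fun _ _ hw => by cases hw⟩
    by_cases hxg : x = g
    · exact ⟨_, Set.mem_insert _ _, by rw [hxg]⟩
    · exact ⟨x, Set.mem_insert_of_mem _ ⟨hx, hxg⟩, rfl⟩
  | vanish G L g =>
    obtain ⟨hg, hr, hs, hlm⟩ := h.work g 0 rfl
    refine ⟨h.inv.of_sig (h.inv.good.mono Set.sdiff_subset) ?_ fun x hx _ => ?_,
      fun _ _ hw => by cases hw⟩
    · rintro s (rfl | hsL)
      · exact hs.isKerLM
      · exact h.inv.isKerLM s hsL
    · by_cases hxg : x = g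
      · exact Or.inl (hxg ▸ hs.isKerLM)
      · exact Or.inr ⟨x, ⟨hx, hxg⟩, rfl⟩

/-- The S-polynomial of a critical pair has the signature of the pair. -/
theorem CritPair.hasSignature (hb : HasPreferredBasis ψ) (hF : IsCompatibleF ψ r)
    (hE : IsCompatibleE V m) (hG : IsGoodSet ψ ghat G) {p : CritPair (r := r) (m := m) ψ}
    {s : EMon V m} {f : Fin r → A} (hp : p.IsPairOf ψ G) (hs : p.HasSig ψ s)
    (hf : p.IsSPoly ψ f) : HasSignature ψ ghat f s := by
  cases p with
  | typeT g c =>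
    obtain rfl : f = op (StdMon.val ψ c) • g.poly := hf
    exact (hG.hasSignature g hp.1).mul hE hs
  | typeS g g' c =>
    obtain ⟨hg, hg', t, s', ht, hm, hlt⟩ := hp
    obtain ⟨u, u', a, a', -, -, rfl⟩ := hf
    obtain rfl : s' = s := hm.2.unique hs
    have h1 := (hG.hasSignature g hg).mul hE hs
    refine h1.sub_smul (hG.hasSignature g' hg') hlt ?_ _
    rw [← (hG.hasSignature g' hg').tgt_eq hb ht]
    exact h1.tgt_eq hb (hm.isLM hb hF)

theorem CritPair.exists_isSPoly {p : CritPair (r := r) (m := m) ψ} (hp : p.IsPairOf ψ G) :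
    ∃ f, p.IsSPoly ψ f := by
  cases p with
  | typeT g c => exact ⟨_, rfl⟩
  | typeS g g' c =>
    obtain ⟨-, -, t, s, ⟨a', ha'⟩, ⟨⟨u, ⟨a, ha⟩, -⟩, -⟩, -⟩ := hp
    exact ⟨_, u, t, a, a', ha, ha', rfl⟩

theorem StateInvariant.step (hP : IsMonomialOrdering V) (hb : HasPreferredBasis ψ)
    (hadm : IsAdmissible ψ) (hF : IsCompatibleF ψ r) (hE : IsCompatibleE V m)
    {x y : State A V r m} (h : StateInvariant ψ ghat hb x) (hxy : Step ψ x y) :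
    StateInvariant ψ ghat hb y := by
  cases hxy with
  | startStep S S' hS => exact InterInvariant.step hb hF hE h hS
  | startDone G L hG =>
    exact ⟨⟨h.inv.good, fun s hs => absurd hs (Set.notMem_empty s), h.inv.exists_sig⟩, hG⟩
  | loopExit G L hexit =>
    exact ⟨h.2, isSignedStandardBasis_of_exit hP hb hadm hF hE h.1.good hexit h.2 h.1.isKerLM
      h.1.exists_sig⟩
  | loopEnter G L p s f hp hf =>
    exact ⟨h.1, h.2, CritPair.hasSignature hb hF hE h.1.good hp.1.1 hp.1.2.1 hf⟩
  | reduce G L s f f' hf => exact ⟨h.1, h.2.1, (hf.hasSignature hb hF hE h.1.good h.2.2).1⟩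
  | zero G L s =>
    refine ⟨⟨h.1.good, ?_, h.1.exists_sig⟩, h.2.1⟩
    rintro s' (rfl | hs')
    · exact h.2.2.isKerLM
    · exact h.1.isKerLM s' hs'
  | nonzero G L s f hf hirr =>
    exact ⟨h.1.of_sig (h.1.good.insert hf h.2.2) h.1.isKerLM
      fun g hg _ => Or.inr ⟨g, Set.mem_insert_of_mem _ hg, rfl⟩, fun _ _ hw => by cases hw⟩
  | updateStep S S' hS => exact InterInvariant.step hb hF hE h hS
  | updateDone G L hG => exact ⟨h.inv, hG⟩

theorem interInvariant_initial (hb : HasPreferredBasis ψ) :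
    InterInvariant ψ ghat hb ⟨initialSet ψ ghat, ∅, none⟩ := by
  refine ⟨⟨⟨?_, fun g hg => hg.1, ?_⟩, fun s hs => absurd hs (Set.notMem_empty s), ?_⟩,
    fun _ _ hw => by cases hw⟩
  · refine (Set.finite_range fun x : Fin m × V =>
      (⟨op (ψ (of K (PathMon.triv x.2))) • ghat x.1, ⟨x.1, PathMon.triv x.2⟩⟩ :
        SPair A V r m)).subset ?_
    rintro g ⟨-, i, v, rfl⟩
    exact ⟨(i, v), rfl⟩
  · rintro g ⟨-, i, v, rfl⟩
    exact hasSignature_initial i v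
  · intro i v hk
    refine ⟨_, ⟨fun h0 => hk ?_, i, v, rfl⟩, rfl⟩
    have h1 := hasSignature_initial (ψ := ψ) (ghat := ghat) i v
    dsimp only at h0
    rw [h0] at h1
    exact h1.isKerLM

theorem InterInvariant.progress (hb : HasPreferredBasis ψ) {S : InterState A V r m} :
    (S.work = none ∧ IsInterreduced ψ S.G) ∨ ∃ S', InterStep ψ S S' := by
  obtain ⟨G, L, _ | ⟨g, f⟩⟩ := S
  · by_cases h : IsInterreduced ψ G
    · exact Or.inl ⟨rfl, h⟩
    right
    rcases not_and_or.1 h with h | h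
    · push Not at h
      obtain ⟨g, hg, hirr⟩ := h
      exact ⟨_, .choose G L g hg ((not_not.1 (not_or.1 hirr).2).diff_singleton hb)⟩
    · push Not at h
      obtain ⟨g, hg, g', hg', hne, hcov⟩ := h
      exact ⟨_, .drop G L g g' hg hg' hne hcov⟩
  · right
    by_cases h0 : f = 0
    · subst h0
      exact ⟨_, .vanish G L g⟩
    by_cases hirr : IsIrreducible ψ f g.sig (G \ {g})
    · exact ⟨_, .replace G L g f h0 hirr⟩
    · obtain ⟨f', hf'⟩ := (not_not.1 (not_or.1 hirr).2).exists_topReduction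
      exact ⟨_, .reduce G L g f f' hf'⟩

/-- The algorithm does not get stuck before it has returned a result. -/
theorem State.progress (hb : HasPreferredBasis ψ) (x : State A V r m) :
    (∃ y, Step ψ x y) ∨ ∃ G, x = .returned G := by
  cases x with
  | start S =>
    rcases InterInvariant.progress hb (S := S) with ⟨h1, h2⟩ | ⟨S', h⟩
    · obtain ⟨G, L, w⟩ := S
      dsimp only at h1
      subst h1
      exact Or.inl ⟨_, .startDone G L h2⟩
    · exact Or.inl ⟨_, .startStep _ _ h⟩
  | loopHead G L =>
    by_cases h : ∀ p s, ¬ LoopCondition ψ G L p s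
    · exact Or.inl ⟨_, .loopExit G L h⟩
    · push Not at h
      obtain ⟨p, s, hp⟩ := h
      obtain ⟨f, hf⟩ := CritPair.exists_isSPoly hp.1.1
      exact Or.inl ⟨_, .loopEnter G L p s f hp hf⟩
  | normalForm G L s f =>
    by_cases h0 : f = 0
    · subst h0
      exact Or.inl ⟨_, .zero G L s⟩
    by_cases hirr : IsIrreducible ψ f s G
    · exact Or.inl ⟨_, .nonzero G L s f h0 hirr⟩
    · obtain ⟨f', hf'⟩ := (not_not.1 (not_or.1 hirr).2).exists_topReduction
      exact Or.inl ⟨_, .reduce G L s f f' hf'⟩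
  | update S =>
    rcases InterInvariant.progress hb (S := S) with ⟨h1, h2⟩ | ⟨S', h⟩
    · obtain ⟨G, L, w⟩ := S
      dsimp only at h1
      subst h1
      exact Or.inl ⟨_, .updateDone G L h2⟩
    · exact Or.inl ⟨_, .updateStep _ _ h⟩
  | returned G => exact Or.inr ⟨G, rfl⟩

theorem halted_returned (G : Set (SPair A V r m)) : Halted ψ (.returned G) := by
  rintro ⟨y, hy⟩
  cases hy

end Invariants

/-! ### Termination between two entries of the loop -/

section Termination

variable {K V A : Type*} [Field K] [Quiver V] [Fintype V] [LinearOrder (PathMon V)]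
  [Ring A] [Algebra K A] {ψ : PathAlgebra K V →ₐ[K] A} {r m : ℕ} {ghat : Fin m → Fin r → A}
  [LinearOrder (FMon ψ r)]
  {G : Set (SPair A V r m)}

/-- The multiset of the leading monomials of a finite set of signed elements. -/
noncomputable def lmMultiset (hb : HasPreferredBasis ψ) (G : Set (SPair A V r m)) :
    Multiset (WithBot (FMon ψ r)) := ∑ᶠ g ∈ G, {lmBot hb g.poly}

theorem lmMultiset_insert (hb : HasPreferredBasis ψ) (hG : G.Finite) {g : SPair A V r m}
    (hg : g ∉ G) : lmMultiset hb (insert g G) = lmMultiset hb G + {lmBot hb g.poly} := by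
  rw [lmMultiset, finsum_mem_insert _ hg hG, add_comm]
  rfl

theorem lmMultiset_eq (hb : HasPreferredBasis ψ) (hG : G.Finite) {g : SPair A V r m}
    (hg : g ∈ G) : lmMultiset hb G = lmMultiset hb (G \ {g}) + {lmBot hb g.poly} := by
  have h : g ∉ G \ {g} := fun h => h.2 rfl
  rw [← lmMultiset_insert hb hG.sdiff h, Set.insert_sdiff_singleton, Set.insert_eq_of_mem hg]

theorem lmMultiset_diff_lt (hb : HasPreferredBasis ψ) (hG : G.Finite) {g : SPair A V r m}
    (hg : g ∈ G) : (lmMultiset hb (G \ {g})).IsDershowitzMannaLT (lmMultiset hb G) := by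
  refine ⟨lmMultiset hb (G \ {g}), 0, {lmBot hb g.poly}, Multiset.singleton_ne_zero _,
    (add_zero _).symm, lmMultiset_eq hb hG hg, fun y hy => absurd hy (Multiset.notMem_zero y)⟩

theorem lmMultiset_replace_lt (hb : HasPreferredBasis ψ) (hG : G.Finite) {g g' : SPair A V r m}
    (hg : g ∈ G) (h : lmBot hb g'.poly < lmBot hb g.poly) :
    (lmMultiset hb (insert g' (G \ {g}))).IsDershowitzMannaLT (lmMultiset hb G) := by
  by_cases hg' : g' ∈ G \ {g}
  · rw [Set.insert_eq_of_mem hg']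
    exact lmMultiset_diff_lt hb hG hg
  · refine ⟨lmMultiset hb (G \ {g}), {lmBot hb g'.poly}, {lmBot hb g.poly},
      Multiset.singleton_ne_zero _, lmMultiset_insert hb hG.sdiff hg', lmMultiset_eq hb hG hg,
      fun y hy => ⟨_, Multiset.mem_singleton_self _, by rwa [Multiset.mem_singleton.1 hy]⟩⟩

/-- The rank of a state of the interreduction procedure: the multiset of leading monomials, followed
by the leading monomial of the current remainder, where `⊤` says that no element is being
reduced. -/
noncomputable def InterState.rank (hb : HasPreferredBasis ψ) (S : InterState A V r m) :
    Multiset (WithBot (FMon ψ r)) × WithTop (WithBot (FMon ψ r)) :=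
  (lmMultiset hb S.G, S.work.elim ⊤ fun x => (lmBot hb x.2 : WithTop (WithBot (FMon ψ r))))

/-- The rank of a state of the algorithm. Its first component gives the order in which the phases
follow each other as long as the body of the loop is not entered. -/
noncomputable def State.rank (hb : HasPreferredBasis ψ) : State A V r m →
    ℕ × Multiset (WithBot (FMon ψ r)) × WithTop (WithBot (FMon ψ r))
  | .start S => (2, S.rank hb)
  | .loopHead _ _ => (1, 0, ⊤)
  | .normalForm _ _ _ f => (3, 0, (lmBot hb f : WithTop (WithBot (FMon ψ r))))
  | .update S => (2, S.rank hb)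
  | .returned _ => (0, 0, ⊤)

variable (ψ r) in
/-- The lexicographic order on the ranks of the states of the interreduction procedure. -/
def InterRankLT : Multiset (WithBot (FMon ψ r)) × WithTop (WithBot (FMon ψ r)) →
    Multiset (WithBot (FMon ψ r)) × WithTop (WithBot (FMon ψ r)) → Prop :=
  Prod.Lex Multiset.IsDershowitzMannaLT (· < ·)

variable (ψ r) in
/-- The lexicographic order on the ranks of the states of the algorithm. -/
def RankLT : ℕ × Multiset (WithBot (FMon ψ r)) × WithTop (WithBot (FMon ψ r)) →
    ℕ × Multiset (WithBot (FMon ψ r)) × WithTop (WithBot (FMon ψ r)) → Prop :=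
  Prod.Lex (· < ·) (InterRankLT ψ r)

theorem wellFounded_rankLT (hadm : IsAdmissible ψ) (hF : IsCompatibleF ψ r) :
    WellFounded (RankLT ψ r) := by
  have := wellFoundedLT_fMon hadm hF
  exact WellFounded.prod_lex wellFounded_lt
    (WellFounded.prod_lex Multiset.wellFounded_isDershowitzMannaLT wellFounded_lt)

variable [LinearOrder (EMon V m)]

theorem InterStep.rank_lt (hb : HasPreferredBasis ψ) (hF : IsCompatibleF ψ r)
    (hE : IsCompatibleE V m) {S S' : InterState A V r m} (h : InterInvariant ψ ghat hb S)
    (hS : InterStep ψ S S') : InterRankLT ψ r (S'.rank hb) (S.rank hb) := by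
  cases hS with
  | drop G L g g' hg hg' hne hcov =>
    exact Prod.Lex.left _ _ (lmMultiset_diff_lt hb h.inv.good.finite hg)
  | choose G L g hg hr => exact Prod.Lex.right _ (WithTop.coe_lt_top _)
  | reduce G L g f f' hf =>
    obtain ⟨hg, hr, hs, hlm⟩ := h.work g f rfl
    exact Prod.Lex.right _ (WithTop.coe_lt_coe.2
      (hf.hasSignature hb hF hE (h.inv.good.mono Set.sdiff_subset) hs).2)
  | replace G L g f hf hirr =>
    obtain ⟨hg, hr, hs, hlm⟩ := h.work g f rfl
    refine Prod.Lex.left _ _ (lmMultiset_replace_lt hb h.inv.good.finite hg ?_)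
    -- `g` was reducible when it was chosen, in contrast to `f`
    rcases hlm with rfl | hlm
    · exact (hirr.elim hf fun h1 => h1 hr).elim
    · exact hlm
  | vanish G L g =>
    exact Prod.Lex.left _ _ (lmMultiset_diff_lt hb h.inv.good.finite (h.work g 0 rfl).1)

/-- Each step of the algorithm diminishes the rank, unless it enters the body of the loop. -/
theorem Step.rank_lt (hb : HasPreferredBasis ψ) (hF : IsCompatibleF ψ r)
    (hE : IsCompatibleE V m) {x y : State A V r m} (h : StateInvariant ψ ghat hb x)
    (hxy : Step ψ x y)
    (hne : ¬ ∃ G L s f, x = .loopHead G L ∧ y = .normalForm G L s f) :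
    RankLT ψ r (y.rank hb) (x.rank hb) := by
  cases hxy with
  | startStep S S' hS => exact Prod.Lex.right _ (hS.rank_lt hb hF hE h)
  | startDone G L hG => exact Prod.Lex.left _ _ (by decide)
  | loopExit G L hexit => exact Prod.Lex.left _ _ (by decide)
  | loopEnter G L p s f hp hf => exact absurd ⟨G, L, s, f, rfl, rfl⟩ hne
  | reduce G L s f f' hf =>
    exact Prod.Lex.right _ (Prod.Lex.right _
      (WithTop.coe_lt_coe.2 (hf.hasSignature hb hF hE h.1.good h.2.2).2))
  | zero G L s => exact Prod.Lex.left _ _ (by decide)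
  | nonzero G L s f hf hirr => exact Prod.Lex.left _ _ (by decide)
  | updateStep S S' hS => exact Prod.Lex.right _ (hS.rank_lt hb hF hE h)
  | updateDone G L hG => exact Prod.Lex.left _ _ (by decide)

end Termination

end SigF5

open SigF5
theorem mainTheorem3
    {V : Type*} [Quiver V] [Fintype V] [∀ a b : V, Finite (a ⟶ b)]
    {K : Type*} [Field K] {A : Type*} [Ring A] [Algebra K A]
    (ψ : PathAlgebra K V →ₐ[K] A) (hψ : Function.Surjective ψ)
    [LinearOrder (PathMon V)] (hP : IsMonomialOrdering V)
    (hbasis : HasPreferredBasis ψ) (hadm : IsAdmissible ψ)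
    (r m : ℕ)
    [LinearOrder (FMon ψ r)] (hF : IsCompatibleF ψ r)
    [LinearOrder (EMon V m)] (hE : IsCompatibleE V m)
    (M : Submodule Aᵐᵒᵖ (Fin r → A)) (ghat : Fin m → Fin r → A)
    (hM : Submodule.span Aᵐᵒᵖ (Set.range ghat) = M)
    (ρ : ℕ → State A V r m) (hρ : IsRun ψ ghat ρ) :
    (∀ n, Halted ψ (ρ n) → ∃ G, ρ n = .returned G ∧
      IsInterreduced ψ G ∧ IsSignedStandardBasis ψ M ghat G) ∧
    ((∃ n, Halted ψ (ρ n)) ↔ (loopRounds ρ).Finite) ∧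
    (∀ n G L, ρ n = .loopHead G L →
      (∀ s ∈ L, IsKerLM ψ ghat s) ∧
      ∀ (i : Fin m) (v : V), ¬ IsKerLM ψ ghat ⟨i, PathMon.triv v⟩ →
        ∃ g ∈ G, g.sig = ⟨i, PathMon.triv v⟩) := by
  subst hM
  obtain ⟨hρ0, hρs⟩ := hρ
  have hinv : ∀ n, StateInvariant ψ ghat hbasis (ρ n) := by
    intro n
    induction n with
    | zero =>
      rw [hρ0]
      exact interInvariant_initial hbasis
    | succ n ih =>
      rcases hρs n with h | ⟨-, h⟩
      · exact ih.step hP hbasis hadm hF hE h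
      · rw [h]
        exact ih
  have hret : ∀ n, Halted ψ (ρ n) → ∃ G, ρ n = .returned G :=
    fun n hn => (State.progress hbasis (ρ n)).resolve_left hn
  refine ⟨fun n hn => ?_, ⟨?_, fun hfin => ?_⟩, fun n G L h => ?_⟩
  · obtain ⟨G, hG⟩ := hret n hn
    have := hinv n
    rw [hG] at this
    exact ⟨G, hG, this⟩
  · rintro ⟨n, hn⟩
    obtain ⟨G, hG⟩ := hret n hn
    have hconst : ∀ k, ρ (n + k) = .returned G := by
      intro k
      induction k with
      | zero => exact hG
      | succ k ih =>
        rcases hρs (n + k) with h | ⟨-, h⟩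
        · rw [ih] at h
          exact absurd ⟨_, h⟩ (halted_returned G)
        · exact h.trans ih
    refine (Set.finite_lt_nat n).subset ?_
    rintro k ⟨G', L, s, f, h1, -⟩
    by_contra hk
    obtain ⟨j, rfl⟩ := Nat.exists_eq_add_of_le (not_lt.1 hk)
    rw [hconst] at h1
    cases h1
  · by_contra hnot
    push Not at hnot
    obtain ⟨N, hN⟩ := hfin.bddAbove
    refine (wellFounded_iff_isEmpty_descending_chain.1 (wellFounded_rankLT hadm hF)).false
      ⟨fun k => (ρ (N + 1 + k)).rank hbasis, fun k => ?_⟩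
    refine Step.rank_lt hbasis hF hE (hinv _) ((hρs _).resolve_right fun h => hnot _ h.1) ?_
    intro h
    have : N + 1 + k ≤ N := hN h
    omega
  · have := hinv n
    rw [h] at this
    exact ⟨this.1.isKerLM, this.1.exists_sig⟩
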